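/- **Setting.** For a finite graph $G$ let $\delta(G)$ and $\Delta(G)$ be its minimum and maximum degree, let $\mu_1\ge\mu_2\ge\dots\ge\mu_n$ be the eigenvalues of its adjacency matrix, and let $\lambda(G)=\max_{2\le i\le n}|\mu_i|$. An *expander sequence* is a sequence $(G_n)_{n\ge 1}$ of connected simple graphs, $G_n$ having $n$ vertices, such that $\Delta(G_n)/\delta(G_n)=1+o(1)$ and $\lambda(G_n)=o(\Delta(G_n))$ as $n\to\infty$. Let $q\in(0,1]$, and let initially exactly one vertex $v$ of $G$ be informed. In each round every vertex chooses, independently and uniformly at random, one of its neighbours; a transmission along the chosen edge succeeds with probability $q$, independently of everything else. In *pull*, an uninformed vertex becomes informed in this round if the neighbour it chose was informed before the round and the transmission succeeds. In *push&pull*, if a vertex or the neighbour it chose was informed before the round and the transmission succeeds, then both are informed afterwards. Informed vertices stay informed. Let $T_{pull}(G,v,q)$ and $T_{pp}(G,v,q)$ be the numbers of rounds until all vertices are informed ($\infty$ if this never happens). For $q\in(0,1)$ put $$c_{pull}(q)=\frac1{\log(1+q)}-\frac1{\log(1-q)},\qquad c_{pp}(q)=\frac1{\log(1+2q)}+\frac1{q-\log(1-q)},$$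 with $\log$ the natural logarithm, and let $c_{pull}(1)=\lim_{q\to1}c_{pull}(q)=1/\log 2$ and $c_{pp}(1)=\lim_{q\to1}c_{pp}(q)=1/\log 3$. **Theorem.** Let $0<\varepsilon<1/2$, $q\in(0,1]$, and let $(G_n)$ be an expander sequence. For each $n$ let $\tilde G_n$ be obtained from $G_n$ by deleting edges in such a way that each vertex $v$ keeps at least a $(1/2+\varepsilon)$ fraction of its edges, that is, $d_{\tilde G_n}(v)\ge(1/2+\varepsilon)\,d_{G_n}(v)$. (a) There is a positive function $g(n)=o(\log n)$ such that, uniformly over the initially informed vertex $v$ of $\tilde G_n$, with probability $1-o(1)$ as $n\to\infty$, $$\bigl|T_{pull}(\tilde G_n,v,q)-c_{pull}(q)\log n\bigr|\le g(n).$$ (b) If additionally there is $0<\alpha\le1$ such that $\delta(G_n)\ge\alpha n$ for all sufficiently large $n$, then there is a positive function $g(n)=o(\log n)$ such that, uniformly over the initially informed vertex $v$ of $\tilde G_n$, with probability $1-o(1)$ as $n\to\infty$, $$T_{pp}(\tilde G_n,v,1)\le c_{pp}(1)\log n+g(n).$$ -/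

import Mathlib

open Filter Topology Asymptotics MeasureTheory ProbabilityTheory

namespace RumorSpreading

noncomputable section

/-! ### Expander sequences -/

/-- `λ(G) = max_{2 ≤ i ≤ |V|} |μ_i|`, where `μ_1 ≥ μ_2 ≥ ⋯` are the eigenvalues (with multiplicity)
of the adjacency matrix of `G`. Here `eigenvalues₀` lists them in decreasing order, indexed from
`0`, so the index `0` is the one left out. -/
def secondEigenvalue {V : Type*} [Fintype V] [DecidableEq V] (G : SimpleGraph V)
    [DecidableRel G.Adj] : ℝ :=
  ⨆ i : {i : Fin (Fintype.card V) // i.val ≠ 0}, |(G.isHermitian_adjMatrix ℝ).eigenvalues₀ i.1|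

/-- `G n` is a connected graph on `n` vertices (for `n ≥ 1`; the graph without vertices is
irrelevant), `Δ_n / δ_n = 1 + o(1)` and `λ_n = o(Δ_n)`. -/
structure IsExpanderSequence (G : ∀ n : ℕ, SimpleGraph (Fin n)) [∀ n, DecidableRel (G n).Adj] :
    Prop where
  connected : ∀ n, 1 ≤ n → (G n).Connected
  degree_ratio : Tendsto (fun n => ((G n).maxDegree : ℝ) / ((G n).minDegree : ℝ)) atTop (𝓝 1)
  eigenvalue_small :
    (fun n => secondEigenvalue (G n)) =o[atTop] (fun n => ((G n).maxDegree : ℝ))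

/-- `G'` arises from `G` by deleting edges so that every vertex keeps at least a fraction `r` of
its edges. -/
structure IsEdgeDeletion {V : Type*} [Fintype V] (G G' : SimpleGraph V)
    [DecidableRel G.Adj] [DecidableRel G'.Adj] (r : ℝ) : Prop where
  le : G' ≤ G
  keeps : ∀ v, r * (G.degree v : ℝ) ≤ (G'.degree v : ℝ)

/-! ### The protocols -/

/-- The outcome of one round: each vertex `v` calls the vertex `(ρ v).1`, and `(ρ v).2` says
whether a transmission along this call succeeds. -/
abbrev Round (V : Type*) := V → V × Bool

/-- The vertex called by `v`: a uniformly random neighbour of `v` (an isolated vertex calls only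
itself, which has no effect). -/
def calledVertex {V : Type*} [Fintype V] (G : SimpleGraph V) [DecidableRel G.Adj] (v : V) :
    PMF V :=
  if h : (G.neighborFinset v).Nonempty then PMF.uniformOfFinset (G.neighborFinset v) h
  else PMF.pure v

/-- The law of one round: all calls and all successes are independent, each call goes to a uniformly
random neighbour, each success has probability `q`. -/
def roundMeasure {V : Type*} [Fintype V] [MeasurableSpace V] (G : SimpleGraph V)
    [DecidableRel G.Adj] (q : unitInterval) : Measure (Round V) :=
  Measure.pi fun v => (calledVertex G v).toMeasure.prod (bernoulliMeasure true false q)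

instance {V : Type*} [Fintype V] [MeasurableSpace V] (G : SimpleGraph V)
    [DecidableRel G.Adj] (q : unitInterval) : IsProbabilityMeasure (roundMeasure G q) := by
  unfold roundMeasure; infer_instance

/-- The law of the whole sequence of independent rounds. -/
def processMeasure {V : Type*} [Fintype V] [MeasurableSpace V] (G : SimpleGraph V)
    [DecidableRel G.Adj] (q : unitInterval) : Measure (ℕ → Round V) :=
  Measure.infinitePi fun _ : ℕ => roundMeasure G q

/-- A protocol: the new set of informed vertices, given the outcome of the round and the set of
vertices informed before it. -/
abbrev Protocol (V : Type*) := Round V → Set V → Set V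

/-- *pull*: an uninformed vertex becomes informed if it calls an informed vertex and the
transmission succeeds. -/
def pull {V : Type*} : Protocol V := fun ρ I =>
  I ∪ {u | (ρ u).1 ∈ I ∧ (ρ u).2 = true}

/-- *push&pull*: if one of the two ends of a call is informed, and the transmission along this call
succeeds, then afterwards both are informed. -/
def pushPull {V : Type*} : Protocol V := fun ρ I =>
  I ∪ {u | (ρ u).1 ∈ I ∧ (ρ u).2 = true} ∪ {u | ∃ w ∈ I, (ρ w).1 = u ∧ (ρ w).2 = true}

/-- The set of informed vertices after `t` rounds, starting from the single informed vertex `v`. -/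
def informed {V : Type*} (P : Protocol V) (v : V) (ω : ℕ → Round V) : ℕ → Set V
  | 0 => {v}
  | t + 1 => P (ω t) (informed P v ω t)

/-- The runtime: the number of rounds until all vertices are informed (`⊤` if this never
happens). -/
def runtime {V : Type*} (P : Protocol V) (v : V) (ω : ℕ → Round V) : ℕ∞ :=
  ⨅ (t : ℕ) (_ : informed P v ω t = Set.univ), (t : ℕ∞)

/-! ### The constants -/

/-- `c_pull(q)`, the value at `q = 1` being the limit for `q → 1`. -/
def cPull (q : ℝ) : ℝ :=
  if q = 1 then 1 / Real.log 2 else 1 / Real.log (1 + q) - 1 / Real.log (1 - q)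

/-- `c_pp(q)`, the value at `q = 1` being the limit for `q → 1`. -/
def cPushPull (q : ℝ) : ℝ :=
  if q = 1 then 1 / Real.log 3 else 1 / Real.log (1 + 2 * q) + 1 / (q - Real.log (1 - q))

theorem tendsto_log_one_sub : Tendsto (fun q : ℝ => Real.log (1 - q)) (𝓝[<] 1) atBot := by
  refine Real.tendsto_log_nhdsGT_zero.comp ?_
  refine tendsto_nhdsWithin_iff.2 ⟨?_, ?_⟩
  · have h : Tendsto (fun q : ℝ => 1 - q) (𝓝 1) (𝓝 (1 - 1)) := tendsto_const_nhds.sub tendsto_id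
    rw [sub_self] at h
    exact h.mono_left nhdsWithin_le_nhds
  · filter_upwards [self_mem_nhdsWithin] with q hq
    simpa using hq

theorem cPull_one_isLimit : Tendsto cPull (𝓝[<] 1) (𝓝 (cPull 1)) := by
  have h1 : Tendsto (fun q : ℝ => 1 / Real.log (1 + q)) (𝓝[<] 1) (𝓝 (1 / Real.log (1 + 1))) := by
    refine Tendsto.mono_left (ContinuousAt.tendsto ?_) nhdsWithin_le_nhds
    refine continuousAt_const.div ?_ (by norm_num)
    exact ContinuousAt.log (by fun_prop) (by norm_num)
  have h2 : Tendsto (fun q : ℝ => 1 / Real.log (1 - q)) (𝓝[<] 1) (𝓝 0) := by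
    simp only [one_div]
    exact tendsto_inv_atBot_zero.comp tendsto_log_one_sub
  have h3 := h1.sub h2
  have hv : cPull 1 = 1 / Real.log (1 + 1) - 0 := by norm_num [cPull]
  rw [hv]
  refine h3.congr' ?_
  filter_upwards [self_mem_nhdsWithin] with q hq
  simp [cPull, ne_of_lt (Set.mem_Iio.1 hq)]

theorem cPushPull_one_isLimit : Tendsto cPushPull (𝓝[<] 1) (𝓝 (cPushPull 1)) := by
  have h1 : Tendsto (fun q : ℝ => 1 / Real.log (1 + 2 * q)) (𝓝[<] 1)
      (𝓝 (1 / Real.log (1 + 2 * 1))) := by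
    refine Tendsto.mono_left (ContinuousAt.tendsto (f := fun q : ℝ => 1 / Real.log (1 + 2 * q)) ?_)
      nhdsWithin_le_nhds
    refine continuousAt_const.div ?_ (by norm_num)
    exact ContinuousAt.log (by fun_prop) (by norm_num)
  have h2 : Tendsto (fun q : ℝ => 1 / (q - Real.log (1 - q))) (𝓝[<] 1) (𝓝 0) := by
    have hq : Tendsto (fun q : ℝ => q) (𝓝[<] 1) (𝓝 1) := nhdsWithin_le_nhds
    have h : Tendsto (fun q : ℝ => q + -Real.log (1 - q)) (𝓝[<] 1) atTop :=
      hq.add_atTop (tendsto_neg_atBot_atTop.comp tendsto_log_one_sub)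
    simp only [one_div, sub_eq_add_neg (_ : ℝ) (Real.log _)]
    exact tendsto_inv_atTop_zero.comp h
  have h3 := h1.add h2
  have hv : cPushPull 1 = 1 / Real.log (1 + 2 * 1) + 0 := by norm_num [cPushPull]
  rw [hv]
  refine h3.congr' ?_
  filter_upwards [self_mem_nhdsWithin] with q hq
  simp [cPushPull, ne_of_lt (Set.mem_Iio.1 hq)]

end

end RumorSpreading

/-!
Write `Δ` for the maximum degree of `G n`, `H` for `G' n`, and `N` for the number of vertices. Since
`λ = o(Δ)` and all degrees are close to `Δ`, a set `S` spans at most `(|S| / N + o(1)) Δ |S|` edge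
ends in `G n`, hence also in `H`. So nearly all edges of `H` at a small set `S` leave it, and since
`H` keeps more than half of the edges at every vertex, a set of at most half of the vertices always
has a boundary of at least `c Δ |S|` edges, with a constant `c > 0`.

*Upper bounds.* While few vertices are informed, a round of pull adds to the volume (the sum of the
degrees in `H`) of the informed set `I` a mean of `q` times the number of edges leaving `I`. So the
volume grows by a factor of nearly `1 + q`, and once `I` is large the variance is small enough for
the mean of its reciprocal to shrink by nearly the same factor; Markov's inequality then bounds the
number of rounds. For push&pull the same works with factor `1 + 2 q` when a vertex of degree `d` has
weight `√d`. At the end nearly all edges at the uninformed vertices lead to informed ones, so the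
number of uninformed vertices shrinks by a factor of nearly `1 - q`. The rounds at the very
beginning, and those between few informed and few uninformed vertices, number `o(log N)` by the
boundary bound.

*Lower bound for pull.* The mean volume grows by a factor of at most `1 + q` per round, so half of
the vertices are still uninformed after `log N / log (1 + q) - o(log N)` rounds. Then each of
them escapes `t` further rounds with probability at least `(1 - q) ^ t`, independently of the
others.
-/

namespace RumorSpreading

noncomputable section

/-! ### Iterated random maps -/

section Transition

variable {Ω α : Type*}

/-- The real-valued indicator function of a set. -/
def chi (S : Set α) : α → ℝ := S.indicator 1

theorem chi_of_mem {S : Set α} {x : α} (h : x ∈ S) : chi S x = 1 := Set.indicator_of_mem h _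

theorem chi_of_notMem {S : Set α} {x : α} (h : x ∉ S) : chi S x = 0 := Set.indicator_of_notMem h _

theorem chi_nonneg (S : Set α) (x : α) : 0 ≤ chi S x :=
  Set.indicator_nonneg (fun _ _ => zero_le_one) x

theorem chi_le_one (S : Set α) (x : α) : chi S x ≤ 1 :=
  Set.indicator_apply_le' (fun _ => le_rfl) fun _ => zero_le_one

theorem chi_mono {S T : Set α} (h : S ⊆ T) (x : α) : chi S x ≤ chi T x :=
  Set.indicator_le_indicator_of_subset h (fun _ => zero_le_one) x

theorem chi_compl (S : Set α) (x : α) : chi Sᶜ x = 1 - chi S x := by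
  simp [chi, Set.indicator_compl]

theorem chi_sq (S : Set α) (x : α) : chi S x ^ 2 = chi S x := by
  by_cases h : x ∈ S
  · simp [chi_of_mem h]
  · simp [chi_of_notMem h]

variable [MeasurableSpace Ω]

/-- The transition operator of the Markov chain that moves from `x` to `P ω x`, where `ω` has the
law `μ`: the value `transition P μ F x` is the mean of `F` after one step from `x`. -/
def transition (P : Ω → α → α) (μ : Measure Ω) (F : α → ℝ) (x : α) : ℝ :=
  ∫ ω, F (P ω x) ∂μ

variable [Finite Ω] [MeasurableSingletonClass Ω]
  {P : Ω → α → α} {μ : Measure Ω} {F F' h : α → ℝ} {A B R : Set α} {x : α} {β m : ℝ}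

theorem transition_le_transition [IsFiniteMeasure μ] {P' : Ω → α → α}
    (hF : ∀ ω, F (P ω x) ≤ F' (P' ω x)) : transition P μ F x ≤ transition P' μ F' x :=
  integral_mono .of_finite .of_finite hF

theorem transition_iterate_mono_on [IsFiniteMeasure μ] (hR : ∀ ω, Set.MapsTo (P ω) R R) (t : ℕ)
    (hF : ∀ y ∈ R, F y ≤ F' y) (hx : x ∈ R) :
    (transition P μ)^[t] F x ≤ (transition P μ)^[t] F' x := by
  induction t generalizing F F' with
  | zero => exact hF x hx
  | succ _ ih => exact ih fun y hy => transition_le_transition fun ω => hF _ (hR ω hy)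

theorem transition_iterate_mono [IsFiniteMeasure μ] (t : ℕ) (hF : ∀ y, F y ≤ F' y) (x : α) :
    (transition P μ)^[t] F x ≤ (transition P μ)^[t] F' x :=
  transition_iterate_mono_on (R := Set.univ) (fun _ _ _ => trivial) t (fun y _ => hF y) trivial

theorem transition_iterate_add_const [IsProbabilityMeasure μ] (t : ℕ) (F : α → ℝ) (c : ℝ) (x : α) :
    (transition P μ)^[t] (fun y => F y + c) x = (transition P μ)^[t] F x + c := by
  induction t generalizing F with
  | zero => rfl
  | succ t ih =>
    have hstep : transition P μ (fun y => F y + c) = fun y => transition P μ F y + c := by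
      funext y
      simp [transition, integral_add Integrable.of_finite Integrable.of_finite]
    rw [Function.iterate_succ_apply, hstep, ih, Function.iterate_succ_apply]

theorem transition_iterate_le_one [IsProbabilityMeasure μ] (t : ℕ) (hF : ∀ y, F y ≤ 1) (x : α) :
    (transition P μ)^[t] F x ≤ 1 := by
  induction t generalizing F with
  | zero => exact hF x
  | succ _ ih =>
    refine ih fun y => ?_
    calc transition P μ F y ≤ transition P μ (fun _ => 1) y :=
          transition_le_transition fun _ => hF _
      _ = 1 := by simp [transition]

theorem transition_iterate_add_chi_le [IsProbabilityMeasure μ] (s t : ℕ) (x : α) {c : ℝ}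
    (hc : 0 ≤ c) (hA : ∀ y ∈ A, (transition P μ)^[t] (chi B) y ≤ c) :
    (transition P μ)^[s + t] (chi B) x ≤ (transition P μ)^[s] (chi Aᶜ) x + c := by
  rw [Function.iterate_add_apply, ← transition_iterate_add_const]
  refine transition_iterate_mono s (fun y => ?_) x
  by_cases hy : y ∈ A
  · rw [chi_of_notMem (not_not.2 hy), zero_add]
    exact hA y hy
  · rw [chi_of_mem hy]
    linarith [transition_iterate_le_one (P := P) (μ := μ) t (chi_le_one B) y]

theorem transition_iterate_le_pow_mul [IsFiniteMeasure μ] (hR : ∀ ω, Set.MapsTo (P ω) R R)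
    (hβ : 0 ≤ β) (hdrift : ∀ y ∈ R, transition P μ h y ≤ β * h y) (t : ℕ) (hx : x ∈ R) :
    (transition P μ)^[t] h x ≤ β ^ t * h x := by
  induction t generalizing x with
  | zero => simp
  | succ t ih =>
    rw [Function.iterate_succ_apply']
    calc transition P μ ((transition P μ)^[t] h) x
        ≤ transition P μ (fun y => β ^ t * h y) x :=
          transition_le_transition fun ω => ih (hR ω hx)
      _ = β ^ t * transition P μ h x := integral_const_mul _ _
      _ ≤ β ^ t * (β * h x) := by gcongr; exact hdrift x hx
      _ = β ^ (t + 1) * h x := by ring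

theorem transition_indicator_compl_le [IsFiniteMeasure μ] (hB : ∀ ω, Set.MapsTo (P ω) B B)
    (h0 : ∀ y, 0 ≤ h y) (hdrift : x ∉ B → transition P μ h x ≤ β * h x) :
    transition P μ (Bᶜ.indicator h) x ≤ β * Bᶜ.indicator h x := by
  by_cases hx : x ∈ B
  · have hstay : ∀ ω, Bᶜ.indicator h (P ω x) = 0 := fun ω =>
      Set.indicator_of_notMem (not_not.2 (hB ω hx)) h
    simp [transition, hstay, hx]
  · rw [Set.indicator_of_mem (show x ∈ Bᶜ from hx)]
    refine le_trans (transition_le_transition fun ω => ?_) (hdrift hx)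
    exact Set.indicator_le_self' (fun y _ => h0 y) _

/-- Markov's inequality for the supermartingale obtained by stopping `β ^ (-t) * h` on `B`. -/
theorem transition_iterate_chi_compl_le [IsFiniteMeasure μ] (hR : ∀ ω, Set.MapsTo (P ω) R R)
    (hB : ∀ ω, Set.MapsTo (P ω) B B) (hβ : 0 ≤ β) (hm : 0 < m) (h0 : ∀ y, 0 ≤ h y)
    (hlow : ∀ y ∈ R, y ∉ B → m ≤ h y) (hdrift : ∀ y ∈ R, y ∉ B → transition P μ h y ≤ β * h y)
    (t : ℕ) (hx : x ∈ R) : (transition P μ)^[t] (chi Bᶜ) x ≤ β ^ t * (h x / m) := by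
  set k : α → ℝ := fun y => h y / m
  have hk0 : ∀ y, 0 ≤ k y := fun y => div_nonneg (h0 y) hm.le
  calc (transition P μ)^[t] (chi Bᶜ) x
      ≤ (transition P μ)^[t] (Bᶜ.indicator k) x := by
        refine transition_iterate_mono_on hR t (fun y hy => ?_) hx
        refine Set.indicator_le_indicator' fun hyB => ?_
        exact (one_le_div hm).2 (hlow y hy hyB)
    _ ≤ β ^ t * Bᶜ.indicator k x := by
        refine transition_iterate_le_pow_mul hR hβ (fun y hy => ?_) t hx
        refine transition_indicator_compl_le hB hk0 fun hyB => ?_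
        calc transition P μ k y = transition P μ h y / m := integral_div _ _
          _ ≤ β * h y / m := by gcongr; exact hdrift y hy hyB
          _ = β * k y := mul_div_assoc _ _ _
    _ ≤ β ^ t * k x := by gcongr; exact Set.indicator_le_self' (fun y _ => hk0 y) x

end Transition

/-! ### The law of the informed set -/

section Informed

variable {V : Type*}

theorem dependsOn_informed (P : Protocol V) (v : V) (t : ℕ) :
    DependsOn (fun ω : ℕ → Round V => informed P v ω t) (Finset.range t : Set ℕ) := by
  intro ω ω' hω
  induction t with
  | zero => rfl
  | succ t ih =>
    have hlast : ω t = ω' t := hω t (by simp)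
    have hprev : informed P v ω t = informed P v ω' t :=
      ih fun s hs => hω s (Finset.range_subset_range.2 t.le_succ hs)
    simp only [informed, hlast, hprev]

theorem exists_informed_eq_restrict (P : Protocol V) (v : V) (t : ℕ) :
    ∃ I : (Finset.range t → Round V) → Set V,
      ∀ ω, informed P v ω t = I ((Finset.range t).restrict ω) := by
  have : Nonempty (Set V) := ⟨∅⟩
  obtain ⟨I, hI⟩ := dependsOn_iff_exists_comp.1 (dependsOn_informed P v t)
  exact ⟨I, congrFun hI⟩

theorem map_restrict_range_prod_eval_infinitePi {Ω : Type*} [MeasurableSpace Ω] (μ : Measure Ω)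
    [IsProbabilityMeasure μ] (t : ℕ) :
    (Measure.infinitePi fun _ : ℕ => μ).map (fun ω => ((Finset.range t).restrict ω, ω t)) =
      ((Measure.infinitePi fun _ : ℕ => μ).map (Finset.range t).restrict).prod μ := by
  have hcoord : iIndepFun (fun (s : ℕ) (ω : ℕ → Ω) => ω s) (Measure.infinitePi fun _ => μ) :=
    iIndepFun_infinitePi (X := fun _ ω => ω) fun _ => measurable_id
  have hindep : IndepFun (Finset.range t).restrict (fun ω : ℕ → Ω => ω t)
      (Measure.infinitePi fun _ => μ) :=
    (hcoord.indepFun_finset (Finset.range t) {t} (by simp) (by fun_prop)).comp (φ := id)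
      (ψ := fun η : ({t} : Finset ℕ) → Ω => η ⟨t, by simp⟩) measurable_id (measurable_pi_apply _)
  have hprod := (indepFun_iff_map_prod_eq_prod_map_map (by fun_prop)
    (measurable_pi_apply t).aemeasurable).1 hindep
  rwa [Measure.infinitePi_map_eval] at hprod

variable [Finite V] [MeasurableSpace V] [MeasurableSingletonClass V]

theorem integral_informed_succ (P : Protocol V) (v : V) (μ : Measure (Round V))
    [IsProbabilityMeasure μ] (t : ℕ) (F : Set V → ℝ) :
    ∫ ω, F (informed P v ω (t + 1)) ∂(Measure.infinitePi fun _ : ℕ => μ) =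
      ∫ ω, transition P μ F (informed P v ω t) ∂(Measure.infinitePi fun _ : ℕ => μ) := by
  obtain ⟨I, hI⟩ := exists_informed_eq_restrict P v t
  set ν := Measure.infinitePi fun _ : ℕ => μ
  have : IsProbabilityMeasure (ν.map (Finset.range t).restrict) :=
    Measure.isProbabilityMeasure_map (by fun_prop)
  let f : (Finset.range t → Round V) × Round V → ℝ := fun p => F (P p.2 (I p.1))
  calc ∫ ω, F (informed P v ω (t + 1)) ∂ν
      = ∫ ω, f ((Finset.range t).restrict ω, ω t) ∂ν := by simp only [informed, hI, f]
    _ = ∫ p, f p ∂(ν.map (Finset.range t).restrict).prod μ := by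
        rw [← map_restrict_range_prod_eval_infinitePi, integral_map (by fun_prop) (by fun_prop)]
    _ = ∫ η, transition P μ F (I η) ∂(ν.map (Finset.range t).restrict) :=
        integral_prod _ .of_finite
    _ = ∫ ω, transition P μ F (informed P v ω t) ∂ν := by
        rw [integral_map (by fun_prop) Integrable.of_finite.aestronglyMeasurable]
        simp only [hI]

theorem integral_informed (P : Protocol V) (v : V) (μ : Measure (Round V))
    [IsProbabilityMeasure μ] (t : ℕ) (F : Set V → ℝ) :
    ∫ ω, F (informed P v ω t) ∂(Measure.infinitePi fun _ : ℕ => μ) =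
      (transition P μ)^[t] F {v} := by
  induction t generalizing F with
  | zero => simp [informed]
  | succ t ih => rw [integral_informed_succ, ih, Function.iterate_succ_apply]

theorem measurableSet_informed_mem (P : Protocol V) (v : V) (t : ℕ) (A : Set (Set V)) :
    MeasurableSet {ω : ℕ → Round V | informed P v ω t ∈ A} := by
  obtain ⟨I, hI⟩ := exists_informed_eq_restrict P v t
  simp only [hI]
  exact Finset.measurable_restrict (X := fun _ => Round V) _
    (Set.toFinite {η | I η ∈ A}).measurableSet

theorem measureReal_informed_mem (P : Protocol V) (v : V) (μ : Measure (Round V))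
    [IsProbabilityMeasure μ] (t : ℕ) (A : Set (Set V)) :
    (Measure.infinitePi fun _ : ℕ => μ).real {ω | informed P v ω t ∈ A} =
      (transition P μ)^[t] (chi A) {v} := by
  rw [← integral_informed, ← integral_indicator_one (measurableSet_informed_mem P v t A)]
  rfl

end Informed

/-! ### The adjacency matrix on vectors of mean zero -/

section Spectral

open Matrix

variable {V : Type*} (G : SimpleGraph V) [DecidableRel G.Adj]

theorem adjMatrix_nonneg (u v : V) : 0 ≤ G.adjMatrix ℝ u v := by
  rw [SimpleGraph.adjMatrix_apply]; split_ifs <;> simp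

theorem adjMatrix_sq (u v : V) : G.adjMatrix ℝ u v ^ 2 = G.adjMatrix ℝ u v := by
  rw [SimpleGraph.adjMatrix_apply]; split_ifs <;> simp

variable [Fintype V]

theorem sum_adjMatrix (u : V) : ∑ v, G.adjMatrix ℝ u v = G.degree u := by
  simpa [mulVec, dotProduct] using G.adjMatrix_mulVec_const_apply (α := ℝ) (a := 1) (v := u)

theorem sum_adjMatrix_le_maxDegree (u : V) : ∑ v, G.adjMatrix ℝ u v ≤ G.maxDegree := by
  rw [sum_adjMatrix]
  exact_mod_cast G.degree_le_maxDegree u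

theorem sq_adjMatrix_mulVec_le (x : V → ℝ) (u : V) :
    (G.adjMatrix ℝ *ᵥ x) u ^ 2 ≤ G.maxDegree * ∑ v, G.adjMatrix ℝ u v * x v ^ 2 := by
  have hCS := Finset.sum_mul_sq_le_sq_mul_sq Finset.univ (fun v => G.adjMatrix ℝ u v)
    (fun v => G.adjMatrix ℝ u v * x v)
  simp only [← mul_assoc, ← sq, mul_pow, adjMatrix_sq] at hCS
  refine hCS.trans (mul_le_mul_of_nonneg_right (sum_adjMatrix_le_maxDegree G u) ?_)
  exact Finset.sum_nonneg fun v _ => mul_nonneg (adjMatrix_nonneg G u v) (sq_nonneg _)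

theorem sum_sq_adjMatrix_mulVec_le (x : V → ℝ) :
    ∑ u, (G.adjMatrix ℝ *ᵥ x) u ^ 2 ≤ (G.maxDegree : ℝ) ^ 2 * ∑ u, x u ^ 2 := by
  calc ∑ u, (G.adjMatrix ℝ *ᵥ x) u ^ 2
      ≤ ∑ u, (G.maxDegree : ℝ) * ∑ v, G.adjMatrix ℝ u v * x v ^ 2 :=
        Finset.sum_le_sum fun u _ => sq_adjMatrix_mulVec_le G x u
    _ = (G.maxDegree : ℝ) * ∑ v, (∑ u, G.adjMatrix ℝ v u) * x v ^ 2 := by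
        rw [← Finset.mul_sum, Finset.sum_comm]
        simp only [Finset.sum_mul, SimpleGraph.adjMatrix_apply, G.adj_comm]
    _ ≤ (G.maxDegree : ℝ) * ∑ v, (G.maxDegree : ℝ) * x v ^ 2 := by
        gcongr with v
        exact sum_adjMatrix_le_maxDegree G v
    _ = _ := by rw [← Finset.mul_sum]; ring

theorem card_mul_sq_minDegree_le :
    (Fintype.card V : ℝ) * (G.minDegree : ℝ) ^ 2 ≤ ∑ u, (G.adjMatrix ℝ *ᵥ fun _ => 1) u ^ 2 := by
  calc (Fintype.card V : ℝ) * (G.minDegree : ℝ) ^ 2 = ∑ _u : V, (G.minDegree : ℝ) ^ 2 := by simp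
    _ ≤ ∑ u, (∑ v, G.adjMatrix ℝ u v) ^ 2 := by
        gcongr with u
        rw [sum_adjMatrix]
        exact_mod_cast G.minDegree_le_degree u
    _ = _ := by simp only [mulVec, dotProduct, mul_one]

theorem sq_sum_mul_le_of_sum_eq_zero {w x : V → ℝ} (hx : ∑ u, x u = 0) :
    (∑ u, w u * x u) ^ 2 ≤ (∑ u, w u ^ 2 - (∑ u, w u) ^ 2 / Fintype.card V) * ∑ u, x u ^ 2 := by
  set s := ∑ u, w u with hs
  set n : ℝ := ((Fintype.card V : ℕ) : ℝ) with hn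
  have hcentre : ∑ u, w u * x u = ∑ u, (w u - s / n) * x u := by
    simp only [sub_mul, Finset.sum_sub_distrib, ← Finset.mul_sum, hx, mul_zero, sub_zero]
  have hvar : ∑ u, (w u - s / n) ^ 2 = ∑ u, w u ^ 2 - s ^ 2 / n := by
    simp only [sub_sq, Finset.sum_add_distrib, Finset.sum_sub_distrib, ← Finset.sum_mul,
      ← Finset.mul_sum, ← hs, Finset.sum_const, Finset.card_univ, nsmul_eq_mul, ← hn]
    rcases eq_or_ne n 0 with h | h
    · simp [h]
    · field_simp; ring
  rw [hcentre, ← hvar]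
  exact Finset.sum_mul_sq_le_sq_mul_sq _ _ _

variable [DecidableEq V]

theorem sum_sq_sum_eigenvectorBasis_mul {A : Matrix V V ℝ} (hA : A.IsHermitian) (x : V → ℝ) :
    ∑ i, (∑ u, hA.eigenvectorBasis i u * x u) ^ 2 = ∑ u, x u ^ 2 := by
  simpa [EuclideanSpace.norm_sq_eq, PiLp.inner_apply, mul_comm] using
    hA.eigenvectorBasis.sum_sq_norm_inner_right (WithLp.toLp 2 x)

theorem sum_sq_eigenvectorBasis {A : Matrix V V ℝ} (hA : A.IsHermitian) (i : V) :
    ∑ u, hA.eigenvectorBasis i u ^ 2 = 1 := by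
  have h := EuclideanSpace.norm_sq_eq (hA.eigenvectorBasis i)
  rw [hA.eigenvectorBasis.orthonormal.1 i] at h
  simpa using h.symm

theorem sum_eigenvectorBasis_mul_mulVec {A : Matrix V V ℝ} (hA : A.IsHermitian) (x : V → ℝ)
    (i : V) : ∑ u, hA.eigenvectorBasis i u * (A *ᵥ x) u =
      hA.eigenvalues i * ∑ u, hA.eigenvectorBasis i u * x u := by
  have hadj : (⇑(hA.eigenvectorBasis i) : V → ℝ) ⬝ᵥ (A *ᵥ x) =
      (A *ᵥ ⇑(hA.eigenvectorBasis i)) ⬝ᵥ x := by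
    rw [dotProduct_mulVec, ← mulVec_transpose]
    congr 2
  rwa [hA.mulVec_eigenvectorBasis i, smul_dotProduct] at hadj

theorem sum_sq_mulVec_eq {A : Matrix V V ℝ} (hA : A.IsHermitian) (x : V → ℝ) :
    ∑ u, (A *ᵥ x) u ^ 2 =
      ∑ i, hA.eigenvalues i ^ 2 * (∑ u, hA.eigenvectorBasis i u * x u) ^ 2 := by
  simp only [← sum_sq_sum_eigenvectorBasis_mul hA (A *ᵥ x), sum_eigenvectorBasis_mul_mulVec,
    mul_pow]

theorem sq_eigenvalues_adjMatrix_le (i : V) :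
    (G.isHermitian_adjMatrix ℝ).eigenvalues i ^ 2 ≤ (G.maxDegree : ℝ) ^ 2 := by
  have h := sum_sq_adjMatrix_mulVec_le G ((G.isHermitian_adjMatrix ℝ).eigenvectorBasis i)
  rw [(G.isHermitian_adjMatrix ℝ).mulVec_eigenvectorBasis i] at h
  simpa [mul_pow, ← Finset.mul_sum, sum_sq_eigenvectorBasis] using h

theorem exists_sq_eigenvalues_le_sq_secondEigenvalue [Nonempty V] :
    ∃ i₀, ∀ i ≠ i₀,
      (G.isHermitian_adjMatrix ℝ).eigenvalues i ^ 2 ≤ secondEigenvalue G ^ 2 := by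
  let e : Fin (Fintype.card V) ≃ V := Fintype.equivOfCardEq (Fintype.card_fin _)
  refine ⟨e ⟨0, Fintype.card_pos⟩, fun i hi => ?_⟩
  have hpos : (e.symm i).val ≠ 0 := fun h =>
    hi (e.symm_apply_eq.1 (Fin.ext h))
  refine sq_le_sq.2 (le_trans ?_ (le_abs_self _))
  exact le_ciSup (f := fun j : {j : Fin (Fintype.card V) // j.val ≠ 0} =>
    |(G.isHermitian_adjMatrix ℝ).eigenvalues₀ j.1|) (Set.finite_range _).bddAbove ⟨e.symm i, hpos⟩

theorem exists_sum_sq_adjMatrix_mulVec_le [Nonempty V] :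
    ∃ w : V → ℝ, ∑ u, w u ^ 2 = 1 ∧ ∀ x : V → ℝ, ∑ u, (G.adjMatrix ℝ *ᵥ x) u ^ 2 ≤
      (G.maxDegree : ℝ) ^ 2 * (∑ u, w u * x u) ^ 2 + secondEigenvalue G ^ 2 * ∑ u, x u ^ 2 := by
  have hA := G.isHermitian_adjMatrix ℝ
  obtain ⟨i₀, hi₀⟩ := exists_sq_eigenvalues_le_sq_secondEigenvalue G
  refine ⟨hA.eigenvectorBasis i₀, sum_sq_eigenvectorBasis hA i₀, fun x => ?_⟩
  rw [sum_sq_mulVec_eq hA, ← sum_sq_sum_eigenvectorBasis_mul hA x,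
    ← Finset.add_sum_erase _ _ (Finset.mem_univ i₀), Finset.mul_sum]
  refine add_le_add (mul_le_mul_of_nonneg_right (sq_eigenvalues_adjMatrix_le G i₀) (sq_nonneg _)) ?_
  calc ∑ i ∈ Finset.univ.erase i₀,
        hA.eigenvalues i ^ 2 * (∑ u, hA.eigenvectorBasis i u * x u) ^ 2
      ≤ ∑ i ∈ Finset.univ.erase i₀,
        secondEigenvalue G ^ 2 * (∑ u, hA.eigenvectorBasis i u * x u) ^ 2 := by
        refine Finset.sum_le_sum fun i hi => mul_le_mul_of_nonneg_right ?_ (sq_nonneg _)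
        exact hi₀ i (Finset.ne_of_mem_erase hi)
    _ ≤ _ := Finset.sum_le_sum_of_subset_of_nonneg (Finset.erase_subset _ _)
        fun i _ _ => by positivity

/-- As `A 1` has entries of size at least `δ`, a top eigenvector is close to a constant vector when
`δ` is close to `Δ`, so it is almost orthogonal to `x`. -/
theorem sum_sq_adjMatrix_mulVec_le_of_sum_eq_zero [Nonempty V] {x : V → ℝ} (hx : ∑ u, x u = 0) :
    ∑ u, (G.adjMatrix ℝ *ᵥ x) u ^ 2 ≤
      ((G.maxDegree : ℝ) ^ 2 - (G.minDegree : ℝ) ^ 2 + 2 * secondEigenvalue G ^ 2) *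
        ∑ u, x u ^ 2 := by
  set L := secondEigenvalue G
  set Δ : ℝ := ((G.maxDegree : ℕ) : ℝ)
  set δ : ℝ := ((G.minDegree : ℕ) : ℝ)
  set n : ℝ := ((Fintype.card V : ℕ) : ℝ)
  have hn : 0 < n := by simpa [n] using Fintype.card_pos (α := V)
  obtain ⟨w, hw, hspec⟩ := exists_sum_sq_adjMatrix_mulVec_le G
  set s := ∑ u, w u
  have hone : n * δ ^ 2 ≤ Δ ^ 2 * s ^ 2 + L ^ 2 * n := by
    refine (card_mul_sq_minDegree_le G).trans ((hspec fun _ => 1).trans (le_of_eq ?_))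
    simp [s, L, n, Δ]
  have hgap : Δ ^ 2 * (1 - s ^ 2 / n) ≤ Δ ^ 2 - δ ^ 2 + L ^ 2 := by
    have : δ ^ 2 ≤ Δ ^ 2 * (s ^ 2 / n) + L ^ 2 := by
      rw [← mul_le_mul_iff_of_pos_left hn]
      refine hone.trans (le_of_eq ?_)
      field_simp
    linarith
  have hproj : (∑ u, w u * x u) ^ 2 ≤ (1 - s ^ 2 / n) * ∑ u, x u ^ 2 := by
    simpa only [hw] using sq_sum_mul_le_of_sum_eq_zero (w := w) hx
  calc ∑ u, (G.adjMatrix ℝ *ᵥ x) u ^ 2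
      ≤ Δ ^ 2 * (∑ u, w u * x u) ^ 2 + L ^ 2 * ∑ u, x u ^ 2 := hspec x
    _ ≤ Δ ^ 2 * ((1 - s ^ 2 / n) * ∑ u, x u ^ 2) + L ^ 2 * ∑ u, x u ^ 2 := by gcongr
    _ = (Δ ^ 2 * (1 - s ^ 2 / n) + L ^ 2) * ∑ u, x u ^ 2 := by ring
    _ ≤ (Δ ^ 2 - δ ^ 2 + L ^ 2 + L ^ 2) * ∑ u, x u ^ 2 := by gcongr
    _ = _ := by ring

end Spectral

/-! ### Weights of vertex sets and edge distribution -/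

section Weights

theorem one_le_ncard {V : Type*} [Finite V] {S : Set V} (h : S.Nonempty) : (1 : ℝ) ≤ S.ncard :=
  Nat.one_le_cast.2 h.ncard_pos

variable {V : Type*} [Fintype V]

theorem sum_chi (S : Set V) : ∑ u, chi S u = S.ncard := by
  classical
  simp [chi, Set.indicator_apply, Set.ncard_eq_toFinset_card']

theorem ncard_compl_eq (S : Set V) : (Sᶜ.ncard : ℝ) = Fintype.card V - S.ncard := by
  simp [← sum_chi, chi_compl]

/-- The total weight of a vertex set. -/
def weight (s : V → ℝ) (S : Set V) : ℝ := ∑ u, chi S u * s u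

theorem weight_mono_set {s : V → ℝ} (hs : ∀ u, 0 ≤ s u) {S T : Set V} (h : S ⊆ T) :
    weight s S ≤ weight s T :=
  Finset.sum_le_sum fun u _ => mul_le_mul_of_nonneg_right (chi_mono h u) (hs u)

theorem weight_mono {s s' : V → ℝ} (h : ∀ u, s u ≤ s' u) (S : Set V) : weight s S ≤ weight s' S :=
  Finset.sum_le_sum fun u _ => mul_le_mul_of_nonneg_left (h u) (chi_nonneg S u)

theorem weight_const (c : ℝ) (S : Set V) : weight (fun _ => c) S = c * S.ncard := by
  rw [weight, ← Finset.sum_mul, sum_chi, mul_comm]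

theorem weight_const_mul (c : ℝ) (s : V → ℝ) (S : Set V) :
    weight (fun u => c * s u) S = c * weight s S := by
  simp only [weight, Finset.mul_sum, mul_left_comm]

theorem weight_nonneg {s : V → ℝ} (hs : ∀ u, 0 ≤ s u) (S : Set V) : 0 ≤ weight s S :=
  Finset.sum_nonneg fun u _ => mul_nonneg (chi_nonneg S u) (hs u)

theorem weight_sub (s s' : V → ℝ) (S : Set V) :
    weight (fun u => s u - s' u) S = weight s S - weight s' S := by
  simp only [weight, mul_sub, Finset.sum_sub_distrib]

theorem weight_compl (s : V → ℝ) (S : Set V) : weight s Sᶜ = ∑ u, s u - weight s S := by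
  simp only [weight, chi_compl, sub_mul, one_mul, Finset.sum_sub_distrib]

theorem weight_singleton (s : V → ℝ) (v : V) : weight s {v} = s v := by
  classical
  simp [weight, chi, Set.indicator_apply]

variable (H : SimpleGraph V) [DecidableRel H.Adj]

/-- The number of neighbours of `u` in `S`, as a real number. -/
def degIn (S : Set V) (u : V) : ℝ := ∑ v, H.adjMatrix ℝ u v * chi S v

theorem degIn_nonneg (S : Set V) (u : V) : 0 ≤ degIn H S u :=
  Finset.sum_nonneg fun v _ => mul_nonneg (adjMatrix_nonneg H u v) (chi_nonneg S v)

theorem degIn_compl (S : Set V) (u : V) : degIn H Sᶜ u = H.degree u - degIn H S u := by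
  simp only [degIn, chi_compl, ← sum_adjMatrix, mul_sub, mul_one, Finset.sum_sub_distrib]

theorem degIn_singleton (u v : V) : degIn H {u} v = H.adjMatrix ℝ v u := by
  rw [← weight_singleton (H.adjMatrix ℝ v) u]
  simp only [degIn, weight, mul_comm]

theorem degIn_le_degree (S : Set V) (u : V) : degIn H S u ≤ H.degree u := by
  linarith [degIn_compl H S u, degIn_nonneg H Sᶜ u]

theorem weight_degIn_symm (S T : Set V) : weight (degIn H S) T = weight (degIn H T) S := by
  simp only [weight, degIn, Finset.mul_sum]
  rw [Finset.sum_comm]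
  refine Finset.sum_congr rfl fun v _ => Finset.sum_congr rfl fun u _ => ?_
  rw [(H.isSymm_adjMatrix (α := ℝ)).apply u v]
  ring

theorem weight_degIn_compl (S : Set V) :
    weight (degIn H Sᶜ) S = weight (H.degree ·) S - weight (degIn H S) S := by
  rw [← weight_sub]
  exact congrArg (weight · S) (funext (degIn_compl H S))

theorem weight_degIn_compl_le_volume (S : Set V) :
    weight (degIn H Sᶜ) S ≤ weight (H.degree ·) S :=
  weight_mono (degIn_le_degree H Sᶜ) S

variable {H}

theorem degIn_mono_graph {H' : SimpleGraph V} [DecidableRel H'.Adj] (h : H ≤ H') (S : Set V)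
    (u : V) : degIn H S u ≤ degIn H' S u := by
  refine Finset.sum_le_sum fun v _ => mul_le_mul_of_nonneg_right ?_ (chi_nonneg S v)
  simp only [SimpleGraph.adjMatrix_apply]
  split_ifs with h1 h2
  exacts [le_rfl, absurd (h h1) h2, zero_le_one, le_rfl]

/-- The edge distribution of dense enough subgraphs of expanders: `D` is the maximum degree of the
expander, `θ` the error and `c` the edge expansion. -/
structure WellSpread (H : SimpleGraph V) [DecidableRel H.Adj] (D θ c : ℝ) : Prop where
  pos : 0 < D
  error_nonneg : 0 ≤ θ
  half_le_degree : ∀ u, D / 2 ≤ H.degree u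
  degree_le : ∀ u, H.degree u ≤ D
  inner_le : ∀ S : Set V, weight (degIn H S) S ≤ (S.ncard / Fintype.card V + θ) * D * S.ncard
  sum_sq_le : ∀ S : Set V,
    ∑ u, degIn H S u ^ 2 ≤ 2 * (S.ncard / Fintype.card V + θ) * D ^ 2 * S.ncard
  boundary_ge : ∀ S : Set V, c * D * min (S.ncard : ℝ) Sᶜ.ncard ≤ weight (degIn H Sᶜ) S

namespace WellSpread

variable {D θ c κ : ℝ}

theorem degree_pos (hH : WellSpread H D θ c) (u : V) : (0 : ℝ) < H.degree u := by
  linarith [hH.half_le_degree u, hH.pos]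

theorem volume_le (hH : WellSpread H D θ c) (I : Set V) :
    weight (H.degree ·) I ≤ D * I.ncard := by
  rw [← weight_const]
  exact weight_mono hH.degree_le I

theorem le_volume (hH : WellSpread H D θ c) (I : Set V) :
    D / 2 * I.ncard ≤ weight (H.degree ·) I := by
  rw [← weight_const]
  exact weight_mono hH.half_le_degree I

theorem volume_pos (hH : WellSpread H D θ c) {I : Set V} (hI : I.Nonempty) :
    0 < weight (H.degree ·) I :=
  (mul_pos (half_pos hH.pos) (one_pos.trans_le (one_le_ncard hI))).trans_le (hH.le_volume I)

theorem inner_le_of_ncard_le (hH : WellSpread H D θ c) (hκ : 0 ≤ κ) {S : Set V}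
    (hS : (S.ncard : ℝ) ≤ κ * Fintype.card V) :
    weight (degIn H S) S ≤ (κ + θ) * D * S.ncard := by
  have hD := hH.pos
  refine (hH.inner_le S).trans ?_
  gcongr
  exact div_le_of_le_mul₀ (Nat.cast_nonneg _) hκ hS

theorem mul_volume_le_boundary_of_small (hH : WellSpread H D θ c) (hκ : 0 ≤ κ) {I : Set V}
    (hI : (I.ncard : ℝ) ≤ κ * Fintype.card V) :
    (1 - 2 * (κ + θ)) * weight (H.degree ·) I ≤ weight (degIn H Iᶜ) I := by
  have hinner := hH.inner_le_of_ncard_le hκ hI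
  have hvol := mul_le_mul_of_nonneg_left (hH.le_volume I) (add_nonneg hκ hH.error_nonneg)
  rw [weight_degIn_compl]
  linarith

theorem mul_volume_le_boundary_of_le_half (hH : WellSpread H D θ c) (hc : 0 ≤ c) {I : Set V}
    (hI : (I.ncard : ℝ) ≤ Fintype.card V / 2) :
    c * weight (H.degree ·) I ≤ weight (degIn H Iᶜ) I := by
  have hboundary := hH.boundary_ge I
  rw [min_eq_left (by linarith [ncard_compl_eq I])] at hboundary
  linarith [mul_le_mul_of_nonneg_left (hH.volume_le I) hc]

theorem mul_volume_compl_le_boundary (hH : WellSpread H D θ c) (hc : 0 ≤ c) (hκ : 0 ≤ κ)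
    (hκ1 : κ ≤ 1) {I : Set V} (hI : κ * Fintype.card V ≤ I.ncard) :
    c * κ * weight (H.degree ·) Iᶜ ≤ weight (degIn H Iᶜ) I := by
  have hD := hH.pos
  have hmin : κ * Iᶜ.ncard ≤ min (I.ncard : ℝ) Iᶜ.ncard := by
    refine le_min (le_trans ?_ hI) (mul_le_of_le_one_left (Nat.cast_nonneg _) hκ1)
    refine mul_le_mul_of_nonneg_left ?_ hκ
    linarith [ncard_compl_eq I, Nat.cast_nonneg (α := ℝ) I.ncard]
  calc c * κ * weight (H.degree ·) Iᶜ ≤ c * κ * (D * Iᶜ.ncard) := by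
        gcongr
        exact hH.volume_le _
    _ = c * D * (κ * Iᶜ.ncard) := by ring
    _ ≤ c * D * min (I.ncard : ℝ) Iᶜ.ncard := by gcongr
    _ ≤ weight (degIn H Iᶜ) I := hH.boundary_ge I

theorem sqrt_le_two_mul_sqrt_degree (hH : WellSpread H D θ c) (u : V) :
    √D ≤ 2 * √(H.degree u) := by
  refine Real.sqrt_le_iff.2 ⟨by positivity, ?_⟩
  rw [mul_pow, Real.sq_sqrt (hH.degree_pos u).le]
  linarith [hH.half_le_degree u, hH.pos]

theorem sqrt_mul_ncard_le (hH : WellSpread H D θ c) (I : Set V) :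
    √D * I.ncard ≤ 2 * weight (fun u => √(H.degree u)) I := by
  rw [← weight_const, ← weight_const_mul]
  exact weight_mono hH.sqrt_le_two_mul_sqrt_degree I

end WellSpread

section ExpanderMixing

open scoped Matrix

variable [Nonempty V]

theorem sum_chi_sub_density (S : Set V) :
    ∑ u, (chi S u - S.ncard / Fintype.card V) = 0 := by
  have hn : (Fintype.card V : ℝ) ≠ 0 := by exact_mod_cast Fintype.card_ne_zero
  simp only [Finset.sum_sub_distrib, sum_chi, Finset.sum_const, Finset.card_univ, nsmul_eq_mul]
  field_simp
  ring

theorem sum_sq_chi_sub_density_le (S : Set V) :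
    ∑ u, (chi S u - S.ncard / Fintype.card V) ^ 2 ≤ S.ncard := by
  set p : ℝ := S.ncard / Fintype.card V
  have hp : 0 ≤ p := by positivity
  calc ∑ u, (chi S u - p) ^ 2 = ∑ u, ((1 - p) * chi S u - p * (chi S u - p)) :=
        Finset.sum_congr rfl fun u _ => by linear_combination chi_sq S u
    _ = (1 - p) * S.ncard := by
        rw [Finset.sum_sub_distrib, ← Finset.mul_sum, ← Finset.mul_sum, sum_chi,
          sum_chi_sub_density, mul_zero, sub_zero]
    _ ≤ S.ncard := mul_le_of_le_one_left (Nat.cast_nonneg _) (by linarith)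

variable [DecidableEq V] (G : SimpleGraph V) [DecidableRel G.Adj]

theorem sum_sq_degIn_sub_le (S : Set V) :
    ∑ u, (degIn G S u - S.ncard / Fintype.card V * G.degree u) ^ 2 ≤
      ((G.maxDegree : ℝ) ^ 2 - (G.minDegree : ℝ) ^ 2 + 2 * secondEigenvalue G ^ 2) * S.ncard := by
  set p : ℝ := S.ncard / Fintype.card V
  have hdeg : (G.minDegree : ℝ) ≤ G.maxDegree := Nat.cast_le.2 G.minDegree_le_maxDegree
  have hdev : ∀ u, degIn G S u - p * G.degree u =
      (G.adjMatrix ℝ *ᵥ fun v => chi S v - p) u := fun u => by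
    simp only [degIn, Matrix.mulVec, dotProduct, mul_sub, Finset.sum_sub_distrib, ← Finset.sum_mul,
      sum_adjMatrix]
    ring
  simp only [hdev]
  refine (sum_sq_adjMatrix_mulVec_le_of_sum_eq_zero G (sum_chi_sub_density S)).trans ?_
  refine mul_le_mul_of_nonneg_left (sum_sq_chi_sub_density_le S) ?_
  have : (G.minDegree : ℝ) ^ 2 ≤ (G.maxDegree : ℝ) ^ 2 := by gcongr
  nlinarith [sq_nonneg (secondEigenvalue G)]

variable {G} {θ : ℝ}

theorem weight_degIn_le_of_spectral (hθ : 0 ≤ θ)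
    (h : (G.maxDegree : ℝ) ^ 2 - (G.minDegree : ℝ) ^ 2 + 2 * secondEigenvalue G ^ 2 ≤
      (θ * G.maxDegree) ^ 2) (S : Set V) :
    weight (degIn G S) S ≤ (S.ncard / Fintype.card V + θ) * G.maxDegree * S.ncard := by
  set p : ℝ := S.ncard / Fintype.card V
  set z : V → ℝ := fun u => degIn G S u - p * G.degree u with hz
  have hdev : weight z S ≤ θ * G.maxDegree * S.ncard := by
    refine (abs_le_of_sq_le_sq' ?_ (by positivity)).2
    calc weight z S ^ 2 ≤ (∑ u, chi S u ^ 2) * ∑ u, z u ^ 2 :=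
          Finset.sum_mul_sq_le_sq_mul_sq _ _ _
      _ ≤ S.ncard * ((θ * G.maxDegree) ^ 2 * S.ncard) := by
          simp only [chi_sq, sum_chi]
          gcongr
          exact (sum_sq_degIn_sub_le G S).trans (by gcongr)
      _ = (θ * G.maxDegree * S.ncard) ^ 2 := by ring
  have hmean : weight (fun u => p * G.degree u) S ≤ p * G.maxDegree * S.ncard := by
    rw [← weight_const]
    refine weight_mono (fun u => ?_) S
    have : (G.degree u : ℝ) ≤ G.maxDegree := Nat.cast_le.2 (G.degree_le_maxDegree u)
    gcongr
  rw [hz, weight_sub] at hdev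
  linarith

theorem sum_sq_degIn_le_of_spectral (hθ : 0 ≤ θ) (hθ1 : θ ≤ 1)
    (h : (G.maxDegree : ℝ) ^ 2 - (G.minDegree : ℝ) ^ 2 + 2 * secondEigenvalue G ^ 2 ≤
      (θ * G.maxDegree) ^ 2) (S : Set V) :
    ∑ u, degIn G S u ^ 2 ≤
      2 * (S.ncard / Fintype.card V + θ) * (G.maxDegree : ℝ) ^ 2 * S.ncard := by
  set Δ : ℝ := (G.maxDegree : ℝ)
  set p : ℝ := S.ncard / Fintype.card V with hp
  have hn : (Fintype.card V : ℝ) ≠ 0 := by exact_mod_cast Fintype.card_ne_zero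
  have hsplit : ∀ u, degIn G S u ^ 2 ≤
      2 * (p * Δ) ^ 2 + 2 * (degIn G S u - p * G.degree u) ^ 2 := fun u => by
    have hmean : (p * G.degree u) ^ 2 ≤ (p * Δ) ^ 2 := by
      have : (G.degree u : ℝ) ≤ Δ := Nat.cast_le.2 (G.degree_le_maxDegree u)
      gcongr
    linarith [sq_nonneg (2 * (p * G.degree u) - degIn G S u)]
  have hmean : Fintype.card V * (p * Δ) ^ 2 = p * Δ ^ 2 * S.ncard := by
    rw [hp]
    field_simp
  have hdev : (θ * Δ) ^ 2 ≤ θ * Δ ^ 2 := by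
    rw [mul_pow]
    gcongr
    exact pow_le_of_le_one hθ hθ1 two_ne_zero
  calc ∑ u, degIn G S u ^ 2
      ≤ ∑ u, (2 * (p * Δ) ^ 2 + 2 * (degIn G S u - p * G.degree u) ^ 2) :=
        Finset.sum_le_sum fun u _ => hsplit u
    _ = 2 * (Fintype.card V * (p * Δ) ^ 2) +
        2 * ∑ u, (degIn G S u - p * G.degree u) ^ 2 := by
        simp only [Finset.sum_add_distrib, Finset.sum_const, Finset.card_univ, nsmul_eq_mul,
          ← Finset.mul_sum]
        ring
    _ ≤ 2 * (p * Δ ^ 2 * S.ncard) + 2 * (θ * Δ ^ 2 * S.ncard) := by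
        rw [hmean]
        gcongr
        exact (sum_sq_degIn_sub_le G S).trans (by gcongr; exact h.trans hdev)
    _ = _ := by ring

end ExpanderMixing

section EdgeDeletion

variable {G G' : SimpleGraph V} [DecidableRel G.Adj] [DecidableRel G'.Adj] {ε θ : ℝ}

theorem IsEdgeDeletion.le_degree (hdel : IsEdgeDeletion G G' (1 / 2 + ε)) (hε : 0 ≤ ε)
    (hratio : (1 - θ) * G.maxDegree ≤ (G.minDegree : ℝ)) (u : V) :
    (1 / 2 + ε) * ((1 - θ) * G.maxDegree) ≤ G'.degree u := by
  have hdeg : (G.minDegree : ℝ) ≤ G.degree u := Nat.cast_le.2 (G.minDegree_le_degree u)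
  exact (mul_le_mul_of_nonneg_left (hratio.trans hdeg) (by linarith)).trans (hdel.keeps u)

/-- At most half of the edges of `G` at a set of at most half of the vertices stay inside it, while
more than half of them survive. -/
theorem IsEdgeDeletion.le_weight_degIn_compl (hdel : IsEdgeDeletion G G' (1 / 2 + ε)) (hε : 0 < ε)
    (hε' : ε < 1 / 2) (hθε : θ ≤ ε / 4) (hratio : (1 - θ) * G.maxDegree ≤ (G.minDegree : ℝ))
    {S : Set V} (hS : (S.ncard : ℝ) / Fintype.card V ≤ 1 / 2)
    (hin : weight (degIn G' S) S ≤ (S.ncard / Fintype.card V + θ) * G.maxDegree * S.ncard) :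
    ε / 2 * G.maxDegree * S.ncard ≤ weight (degIn G' Sᶜ) S := by
  have hvol : (1 / 2 + ε) * ((1 - θ) * G.maxDegree) * S.ncard ≤ weight (G'.degree ·) S := by
    rw [← weight_const]
    exact weight_mono (hdel.le_degree hε.le hratio) S
  have hinner : weight (degIn G' S) S ≤ (1 / 2 + θ) * G.maxDegree * S.ncard :=
    hin.trans (by gcongr)
  have hgap : ε / 2 ≤ (1 / 2 + ε) * (1 - θ) - (1 / 2 + θ) := by nlinarith
  have := mul_le_mul_of_nonneg_right hgap (by positivity : (0 : ℝ) ≤ G.maxDegree * S.ncard)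
  rw [weight_degIn_compl]
  linarith

theorem IsEdgeDeletion.wellSpread [Nonempty V] [DecidableEq V]
    (hdel : IsEdgeDeletion G G' (1 / 2 + ε)) (hε : 0 < ε) (hε' : ε < 1 / 2) (hθ : 0 ≤ θ)
    (hθε : θ ≤ ε / 4) (hpos : 0 < G.maxDegree)
    (hratio : (1 - θ) * G.maxDegree ≤ (G.minDegree : ℝ))
    (h : (G.maxDegree : ℝ) ^ 2 - (G.minDegree : ℝ) ^ 2 + 2 * secondEigenvalue G ^ 2 ≤
      (θ * G.maxDegree) ^ 2) :
    WellSpread G' G.maxDegree θ (ε / 2) where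
  pos := Nat.cast_pos.2 hpos
  error_nonneg := hθ
  half_le_degree u := by
    have hhalf : 1 / 2 ≤ (1 / 2 + ε) * (1 - θ) := by nlinarith
    have := mul_le_mul_of_nonneg_right hhalf (Nat.cast_nonneg (α := ℝ) G.maxDegree)
    linarith [hdel.le_degree hε.le hratio u]
  degree_le u := Nat.cast_le.2
    ((SimpleGraph.degree_le_of_le hdel.le).trans (G.degree_le_maxDegree u))
  inner_le S :=
    (weight_mono (degIn_mono_graph hdel.le S) S).trans (weight_degIn_le_of_spectral hθ h S)
  sum_sq_le S := le_trans
    (Finset.sum_le_sum fun u _ =>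
      pow_le_pow_left₀ (degIn_nonneg G' S u) (degIn_mono_graph hdel.le S u) 2)
    (sum_sq_degIn_le_of_spectral hθ (by linarith) h S)
  boundary_ge S := by
    have hboundary : ∀ T : Set V, (T.ncard : ℝ) / Fintype.card V ≤ 1 / 2 →
        ε / 2 * G.maxDegree * T.ncard ≤ weight (degIn G' Tᶜ) T := fun T hT =>
      hdel.le_weight_degIn_compl hε hε' hθε hratio hT <|
        (weight_mono (degIn_mono_graph hdel.le T) T).trans (weight_degIn_le_of_spectral hθ h T)
    have hn : (0 : ℝ) < Fintype.card V := Nat.cast_pos.2 Fintype.card_pos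
    rcases le_total ((S.ncard : ℝ) / Fintype.card V) (1 / 2) with hS | hS
    · exact le_trans (by gcongr; exact min_le_left _ _) (hboundary S hS)
    · have hSc : (Sᶜ.ncard : ℝ) / Fintype.card V ≤ 1 / 2 := by
        rw [ncard_compl_eq, sub_div, div_self hn.ne']
        linarith
      have hbound := hboundary Sᶜ hSc
      rw [compl_compl, weight_degIn_symm] at hbound
      exact le_trans (by gcongr; exact min_le_right _ _) hbound

end EdgeDeletion

theorem IsExpanderSequence.eventually_le_minDegree {G : ∀ n : ℕ, SimpleGraph (Fin n)}
    [∀ n, DecidableRel (G n).Adj] (hG : IsExpanderSequence G) {r : ℝ} (hr0 : 0 < r) (hr : r < 1) :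
    ∀ᶠ n in atTop, 0 < (G n).maxDegree ∧ r * (G n).maxDegree ≤ ((G n).minDegree : ℝ) := by
  filter_upwards [hG.degree_ratio.eventually_lt_const ((one_lt_div hr0).2 hr),
    hG.degree_ratio.eventually_const_lt one_pos] with n hlt hpos
  have hmin : (0 : ℝ) < (G n).minDegree := (Nat.cast_nonneg _).lt_of_ne fun h => by
    simp [← h] at hpos
  refine ⟨(Nat.cast_pos.1 hmin).trans_le (G n).minDegree_le_maxDegree, ?_⟩
  rw [div_lt_div_iff₀ hmin hr0] at hlt
  linarith

theorem IsExpanderSequence.eventually_wellSpread {G G' : ∀ n : ℕ, SimpleGraph (Fin n)}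
    [∀ n, DecidableRel (G n).Adj] [∀ n, DecidableRel (G' n).Adj] (hG : IsExpanderSequence G)
    {ε θ : ℝ} (hε : 0 < ε) (hε' : ε < 1 / 2)
    (hG' : ∀ n, IsEdgeDeletion (G n) (G' n) (1 / 2 + ε)) (hθ : 0 < θ) (hθε : θ ≤ ε / 4) :
    ∀ᶠ n in atTop, WellSpread (G' n) (G n).maxDegree θ (ε / 2) := by
  have hr : 0 < 1 - θ ^ 2 / 4 := by nlinarith
  filter_upwards [hG.eventually_le_minDegree hr (by linarith [sq_pos_of_pos hθ]),
    hG.eigenvalue_small.bound (half_pos hθ), eventually_ge_atTop 1] with n hdeg hev hn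
  have : Nonempty (Fin n) := ⟨⟨0, hn⟩⟩
  refine (hG' n).wellSpread hε hε' hθ.le hθε hdeg.1 (le_trans ?_ hdeg.2) ?_
  · gcongr
    nlinarith
  · set Δ : ℝ := ((G n).maxDegree : ℝ)
    rw [Real.norm_eq_abs, Real.norm_natCast] at hev
    have hev' : secondEigenvalue (G n) ^ 2 ≤ (θ / 2 * Δ) ^ 2 := by
      rw [← sq_abs]
      gcongr
    have hmin : ((1 - θ ^ 2 / 4) * Δ) ^ 2 ≤ ((G n).minDegree : ℝ) ^ 2 := by
      gcongr
      exact hdeg.2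
    nlinarith [sq_nonneg (θ ^ 2 * Δ)]

end Weights

/-! ### Moments of sums of independent variables -/

section Moments

variable {ι Ω : Type*} [Fintype ι] [Finite Ω] [MeasurableSpace Ω] [MeasurableSingletonClass Ω]
  {μ : ι → Measure Ω} [∀ i, IsProbabilityMeasure (μ i)]

theorem integral_pi_sum (g : ι → Ω → ℝ) :
    ∫ ω, ∑ i, g i (ω i) ∂(Measure.pi μ) = ∑ i, ∫ x, g i x ∂μ i := by
  rw [integral_finsetSum _ fun i _ => .of_finite]
  exact Finset.sum_congr rfl fun i _ => integral_comp_eval (by fun_prop)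

theorem variance_pi_sum_le (g : ι → Ω → ℝ) :
    Var[fun ω => ∑ i, g i (ω i); Measure.pi μ] ≤ ∑ i, ∫ x, g i x ^ 2 ∂μ i := by
  have h := variance_sum_pi (μ := μ) (X := g) fun i => MemLp.of_discrete
  simp only [Finset.sum_fn] at h
  rw [h]
  exact Finset.sum_le_sum fun i _ => variance_le_expectation_sq (by fun_prop)

theorem variance_pi_sum_le_mul {b : ℝ} {g : ι → Ω → ℝ} (hg : ∀ i x, 0 ≤ g i x)
    (hb : ∀ i x, g i x ≤ b) :
    Var[fun ω => ∑ i, g i (ω i); Measure.pi μ] ≤ b * ∑ i, ∫ x, g i x ∂μ i := by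
  refine (variance_pi_sum_le g).trans ?_
  simp only [Finset.mul_sum, ← integral_const_mul]
  refine Finset.sum_le_sum fun i _ => integral_mono .of_finite .of_finite fun x => ?_
  rw [sq]
  exact mul_le_mul_of_nonneg_right (hb i x) (hg i x)

theorem integral_sq_pi_sum_le (g : ι → Ω → ℝ) :
    ∫ ω, (∑ i, g i (ω i)) ^ 2 ∂(Measure.pi μ) ≤
      (∑ i, ∫ x, g i x ∂μ i) ^ 2 + ∑ i, ∫ x, g i x ^ 2 ∂μ i := by
  have h := variance_pi_sum_le (μ := μ) g
  rw [variance_eq_sub MemLp.of_discrete, integral_pi_sum] at h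
  simp only [Pi.pow_apply] at h
  linarith

end Moments

section Reciprocals

theorem one_div_add_le_tangent {x m s : ℝ} (hx : 0 < x) (hm : 0 ≤ m) (hs : 0 ≤ s) :
    1 / (x + s) ≤ 1 / (x + m) - (s - m) / (x + m) ^ 2 + (s - m) ^ 2 / x ^ 3 := by
  have hexp : 1 / (x + s) =
      1 / (x + m) - (s - m) / (x + m) ^ 2 + (s - m) ^ 2 / ((x + m) ^ 2 * (x + s)) := by
    field_simp
    ring
  rw [hexp]
  gcongr
  calc x ^ 3 = x ^ 2 * x := by ring
    _ ≤ (x + m) ^ 2 * (x + s) := by gcongr <;> linarith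

theorem one_div_add_le_of_le_add {x y s c : ℝ} (hx : 0 < x) (hy : 0 ≤ y) (hs : 0 ≤ s)
    (hc : 0 ≤ c) (h : s ≤ y + c) : 1 / (x + y) ≤ 1 / (x + s) + c / x ^ 2 := by
  have hexp : 1 / (x + y) = 1 / (x + y + c) + c / ((x + y) * (x + y + c)) := by
    field_simp
  rw [hexp]
  gcongr ?_ + c / ?_
  · exact one_div_le_one_div_of_le (by linarith) (by linarith)
  · rw [sq]
    gcongr <;> linarith

variable {Ω : Type*} [Finite Ω] [MeasurableSpace Ω] [MeasurableSingletonClass Ω]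

theorem integral_one_div_add_le {μ : Measure Ω} [IsProbabilityMeasure μ] {x : ℝ} (hx : 0 < x)
    {Y S C : Ω → ℝ} (hY : ∀ ω, 0 ≤ Y ω) (hS : ∀ ω, 0 ≤ S ω) (hC : ∀ ω, 0 ≤ C ω)
    (h : ∀ ω, S ω ≤ Y ω + C ω) :
    ∫ ω, 1 / (x + Y ω) ∂μ ≤
      1 / (x + ∫ ω, S ω ∂μ) + Var[S; μ] / x ^ 3 + (∫ ω, C ω ∂μ) / x ^ 2 := by
  set m := ∫ ω, S ω ∂μ with hm
  have hm0 : 0 ≤ m := integral_nonneg hS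
  calc ∫ ω, 1 / (x + Y ω) ∂μ
      ≤ ∫ ω, (1 / (x + m) - (S ω - m) / (x + m) ^ 2 + (S ω - m) ^ 2 / x ^ 3 + C ω / x ^ 2) ∂μ :=
        integral_mono .of_finite .of_finite fun ω =>
          (one_div_add_le_of_le_add hx (hY ω) (hS ω) (hC ω) (h ω)).trans
            (add_le_add_left (one_div_add_le_tangent hx hm0 (hS ω)) _)
    _ = _ := by
        rw [integral_add .of_finite .of_finite, integral_add .of_finite .of_finite,
          integral_sub .of_finite .of_finite, integral_div, integral_div, integral_div,
          integral_sub .of_finite .of_finite, ← hm, variance_eq_integral (by fun_prop)]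
        simp [hm, integral_div]

/-- The variance is quadratic in the thinning parameter `τ`, the drift linear. -/
theorem integral_one_div_add_pi_sum_le {ι : Type*} [Fintype ι] {μ : ι → Measure Ω}
    [∀ i, IsProbabilityMeasure (μ i)] {x b τ : ℝ} (hx : 0 < x) (hτ : 0 ≤ τ) (hτ1 : τ ≤ 1)
    {g : ι → Ω → ℝ} (hg : ∀ i y, 0 ≤ g i y) (hb : ∀ i y, g i y ≤ b) :
    ∫ ω, 1 / (x + ∑ i, g i (ω i)) ∂(Measure.pi μ) ≤
      1 / (x + τ * ∑ i, ∫ y, g i y ∂μ i) + τ ^ 2 * (b * ∑ i, ∫ y, g i y ∂μ i) / x ^ 3 := by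
  have hsum : ∀ ω : ι → Ω, 0 ≤ ∑ i, g i (ω i) := fun ω => Finset.sum_nonneg fun i _ => hg i _
  refine (integral_one_div_add_le (S := fun ω => τ * ∑ i, g i (ω i)) (C := 0) hx hsum
    (fun ω => mul_nonneg hτ (hsum ω)) (fun _ => le_rfl)
    fun ω => (mul_le_of_le_one_left (hsum ω) hτ1).trans_eq (add_zero _).symm).trans ?_
  rw [integral_const_mul, integral_pi_sum, variance_const_mul]
  simp only [Pi.zero_apply, integral_zero, zero_div, add_zero]
  gcongr
  exact variance_pi_sum_le_mul hg hb

end Reciprocals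

/-! ### One round of pull -/

section Calls

variable {V : Type*}

theorem chi_prod {α β : Type*} (S : Set α) (T : Set β) (x : α × β) :
    chi (S ×ˢ T) x = chi S x.1 * chi T x.2 := Set.indicator_prod_one

variable [Fintype V] [MeasurableSpace V]

/-- The law of the call of a single vertex. -/
def callMeasure (H : SimpleGraph V) [DecidableRel H.Adj] (q : unitInterval) (u : V) :
    Measure (V × Bool) :=
  (calledVertex H u).toMeasure.prod (bernoulliMeasure true false q)

instance (H : SimpleGraph V) [DecidableRel H.Adj] (q : unitInterval) (u : V) :
    IsProbabilityMeasure (callMeasure H q u) := by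
  unfold callMeasure; infer_instance

theorem roundMeasure_eq (H : SimpleGraph V) [DecidableRel H.Adj] (q : unitInterval) :
    roundMeasure H q = Measure.pi (callMeasure H q) := rfl

theorem integral_chi_callMeasure [MeasurableSingletonClass V] (H : SimpleGraph V)
    [DecidableRel H.Adj] (q : unitInterval) {u : V} (hu : (0 : ℝ) < H.degree u) (S : Set V) :
    ∫ x, chi (S ×ˢ {true}) x ∂(callMeasure H q u) = q * (degIn H S u / H.degree u) := by
  have hne : (H.neighborFinset u).Nonempty := by
    rw [← Finset.card_pos, SimpleGraph.card_neighborFinset_eq_degree]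
    exact Nat.cast_pos.1 hu
  simp only [chi_prod]
  rw [callMeasure, integral_prod_mul, integral_bernoulliMeasure, PMF.integral_eq_sum]
  simp only [chi, Set.mem_singleton_iff, Set.indicator_of_mem, Set.indicator_of_notMem,
    Bool.false_eq_true, not_false_eq_true, Pi.one_apply, smul_eq_mul, mul_one, mul_zero, add_zero]
  rw [mul_comm, degIn, Finset.sum_div]
  congr 1
  refine Finset.sum_congr rfl fun w _ => ?_
  simp only [calledVertex, hne, dif_pos, PMF.uniformOfFinset_apply, SimpleGraph.mem_neighborFinset,
    SimpleGraph.adjMatrix_apply, SimpleGraph.card_neighborFinset_eq_degree]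
  split_ifs with h
  · simp [chi, div_eq_mul_inv, mul_comm]
  · simp

end Calls

section Pull

theorem subset_pull {V : Type*} (ρ : Round V) (I : Set V) : I ⊆ pull ρ I :=
  Set.subset_union_left

theorem chi_pull {V : Type*} (ρ : Round V) (I : Set V) (u : V) :
    chi (pull ρ I) u = chi I u + chi Iᶜ u * chi (I ×ˢ {true}) (ρ u) := by
  by_cases h1 : u ∈ I <;> by_cases h2 : (ρ u).1 ∈ I <;> by_cases h3 : (ρ u).2 = true <;>
    simp [chi, pull, h1, h2, h3]

theorem one_sub_mul_chi_nonneg {V : Type*} {a : ℝ} (ha : a ≤ 1) (S : Set V) (u : V) :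
    0 ≤ 1 - a * chi S u :=
  sub_nonneg.2 (mul_le_one₀ ha (chi_nonneg S u) (chi_le_one S u))

variable {V : Type*} [Fintype V]

theorem weight_pull (s : V → ℝ) (ρ : Round V) (I : Set V) :
    weight s (pull ρ I) = weight s I + ∑ u, chi Iᶜ u * s u * chi (I ×ˢ {true}) (ρ u) := by
  simp only [weight, chi_pull, ← Finset.sum_add_distrib]
  exact Finset.sum_congr rfl fun u _ => by ring

/-- The probability that each uninformed vertex escapes an event of probability `a`, independently
of the others. -/
def survival (a : ℝ) (I : Set V) : ℝ := ∏ u, (1 - a * chi Iᶜ u)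

theorem survival_le_exp {a : ℝ} (ha : a ≤ 1) (I : Set V) :
    survival a I ≤ Real.exp (-(a * Iᶜ.ncard)) := by
  rw [survival, ← sum_chi, Finset.mul_sum, ← Finset.sum_neg_distrib, Real.exp_sum]
  exact Finset.prod_le_prod (fun u _ => one_sub_mul_chi_nonneg ha _ u)
    fun u _ => Real.one_sub_le_exp_neg _

variable [MeasurableSpace V] [MeasurableSingletonClass V]
  {H : SimpleGraph V} [DecidableRel H.Adj] (q : unitInterval)

theorem sum_integral_pull_gain (hdeg : ∀ u, (0 : ℝ) < H.degree u) (s : V → ℝ) (I : Set V) :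
    ∑ u, ∫ x, chi Iᶜ u * s u * chi (I ×ˢ {true}) x ∂(callMeasure H q u) =
      q * weight (fun u => s u * (degIn H I u / H.degree u)) Iᶜ := by
  simp only [integral_const_mul, integral_chi_callMeasure H q (hdeg _), weight, Finset.mul_sum]
  exact Finset.sum_congr rfl fun u _ => by ring

theorem sum_integral_pull_volume_gain (hdeg : ∀ u, (0 : ℝ) < H.degree u) (I : Set V) :
    ∑ u, ∫ x, chi Iᶜ u * H.degree u * chi (I ×ˢ {true}) x ∂(callMeasure H q u) =
      q * weight (degIn H Iᶜ) I := by
  rw [sum_integral_pull_gain q hdeg, weight_degIn_symm]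
  simp only [mul_div_cancel₀ _ (hdeg _).ne']

theorem integral_weight_pull (hdeg : ∀ u, (0 : ℝ) < H.degree u) (s : V → ℝ) (I : Set V) :
    ∫ ρ, weight s (pull ρ I) ∂(roundMeasure H q) =
      weight s I + q * weight (fun u => s u * (degIn H I u / H.degree u)) Iᶜ := by
  simp only [weight_pull]
  rw [integral_add .of_finite .of_finite, roundMeasure_eq,
    integral_pi_sum fun u x => chi Iᶜ u * s u * chi (I ×ˢ {true}) x, sum_integral_pull_gain q hdeg]
  simp

theorem integral_volume_pull (hdeg : ∀ u, (0 : ℝ) < H.degree u) (I : Set V) :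
    ∫ ρ, weight (H.degree ·) (pull ρ I) ∂(roundMeasure H q) =
      weight (H.degree ·) I + q * weight (degIn H Iᶜ) I := by
  rw [integral_weight_pull q hdeg, ← sum_integral_pull_gain q hdeg,
    sum_integral_pull_volume_gain q hdeg]

theorem transition_pull_weight_compl (hdeg : ∀ u, (0 : ℝ) < H.degree u) (s : V → ℝ) (I : Set V) :
    transition pull (roundMeasure H q) (fun J => weight s Jᶜ) I =
      weight s Iᶜ - q * weight (fun u => s u * (degIn H I u / H.degree u)) Iᶜ := by
  simp only [transition, weight_compl s]
  rw [integral_sub .of_finite .of_finite, integral_weight_pull q hdeg]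
  simp [sub_sub]

theorem transition_pull_volume_le (hdeg : ∀ u, (0 : ℝ) < H.degree u) (I : Set V) :
    transition pull (roundMeasure H q) (weight (H.degree ·)) I ≤
      (1 + q) * weight (H.degree ·) I := by
  rw [transition, integral_volume_pull q hdeg, one_add_mul]
  have hq := q.2.1
  gcongr
  exact weight_degIn_compl_le_volume H I

theorem transition_pull_survival_le (hdeg : ∀ u, (0 : ℝ) < H.degree u) {a : ℝ} (ha : 0 ≤ a)
    (ha1 : a ≤ 1) (I : Set V) :
    transition pull (roundMeasure H q) (survival a) I ≤ survival (a * (1 - q)) I := by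
  set f : V → V × Bool → ℝ := fun u x =>
    (1 - a * chi Iᶜ u) + a * chi Iᶜ u * chi (I ×ˢ {true}) x
  have hpull : ∀ ρ : Round V, survival a (pull ρ I) = ∏ u, f u (ρ u) := fun ρ =>
    Finset.prod_congr rfl fun u _ => by simp only [f, chi_compl, chi_pull]; ring
  simp only [transition, hpull]
  rw [roundMeasure_eq, integral_fintype_prod_eq_prod f]
  have hU : ∀ u, 0 ≤ a * chi Iᶜ u := fun u => mul_nonneg ha (chi_nonneg _ _)
  refine Finset.prod_le_prod (fun u _ => integral_nonneg fun x => add_nonneg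
    (one_sub_mul_chi_nonneg ha1 _ _) (mul_nonneg (hU u) (chi_nonneg _ _))) fun u _ => ?_
  have hcall : (q : ℝ) * (degIn H I u / H.degree u) ≤ q :=
    mul_le_of_le_one_right q.2.1 ((div_le_one (hdeg u)).2 (degIn_le_degree H I u))
  have hint : ∫ x, f u x ∂(callMeasure H q u) =
      1 - a * chi Iᶜ u + a * chi Iᶜ u * (q * (degIn H I u / H.degree u)) := by
    rw [integral_add .of_finite .of_finite, integral_const_mul,
      integral_chi_callMeasure H q (hdeg u)]
    simp
  rw [hint]
  linarith [mul_le_mul_of_nonneg_left hcall (hU u)]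

theorem transition_iterate_pull_univ_le_survival (hdeg : ∀ u, (0 : ℝ) < H.degree u) (t : ℕ)
    (I : Set V) :
    (transition pull (roundMeasure H q))^[t] (chi {Set.univ}) I ≤ survival ((1 - q) ^ t) I := by
  have hq : (0 : ℝ) ≤ 1 - q := sub_nonneg.2 q.2.2
  have hq1 : (1 - q : ℝ) ≤ 1 := sub_le_self 1 q.2.1
  induction t generalizing I with
  | zero =>
    by_cases h : I = Set.univ
    · simp [h, chi, survival]
    · rw [Function.iterate_zero_apply, chi_of_notMem (by simpa using h), pow_zero]
      exact Finset.prod_nonneg fun u _ => one_sub_mul_chi_nonneg le_rfl _ u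
  | succ t ih =>
    rw [Function.iterate_succ_apply', pow_succ]
    exact (transition_le_transition fun ρ => ih _).trans
      (transition_pull_survival_le q hdeg (pow_nonneg hq t) (pow_le_one₀ hq hq1) I)

theorem transition_iterate_pull_univ_le (hdeg : ∀ u, (0 : ℝ) < H.degree u) (t : ℕ) (I : Set V) :
    (transition pull (roundMeasure H q))^[t] (chi {Set.univ}) I ≤
      Real.exp (-((1 - q) ^ t * Iᶜ.ncard)) :=
  (transition_iterate_pull_univ_le_survival q hdeg t I).trans
    (survival_le_exp (pow_le_one₀ (sub_nonneg.2 q.2.2) (sub_le_self 1 q.2.1)) I)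

namespace WellSpread

variable {D θ c κ : ℝ}

theorem transition_pull_inv_volume_le (hH : WellSpread H D θ c) {τ : ℝ} (hτ : 0 ≤ τ)
    (hτ1 : τ ≤ 1) {I : Set V} (hI : I.Nonempty) :
    transition pull (roundMeasure H q) (fun J => 1 / weight (H.degree ·) J) I ≤
      (1 / (1 + τ * (q * (weight (degIn H Iᶜ) I / weight (H.degree ·) I))) +
        τ ^ 2 * (2 / I.ncard) * (q * (weight (degIn H Iᶜ) I / weight (H.degree ·) I))) *
        (1 / weight (H.degree ·) I) := by
  set X := weight (H.degree ·) I
  set E := (q : ℝ) * weight (degIn H Iᶜ) I with hE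
  have hX : 0 < X := hH.volume_pos hI
  have hE0 : 0 ≤ E := mul_nonneg q.2.1 (weight_nonneg (degIn_nonneg H _) I)
  have hn : (0 : ℝ) < I.ncard := one_pos.trans_le (one_le_ncard hI)
  have hgain : ∀ u, 0 ≤ chi Iᶜ u * H.degree u :=
    fun u => mul_nonneg (chi_nonneg _ _) (hH.degree_pos u).le
  have hreciprocal := integral_one_div_add_pi_sum_le (μ := callMeasure H q) (b := D) hX hτ hτ1
    (g := fun u x => chi Iᶜ u * H.degree u * chi (I ×ˢ {true}) x)
    (fun u x => mul_nonneg (hgain u) (chi_nonneg _ _))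
    (fun u x => (mul_le_of_le_one_right (hgain u) (chi_le_one _ _)).trans
      ((mul_le_of_le_one_left (hH.degree_pos u).le (chi_le_one _ _)).trans (hH.degree_le u)))
  rw [sum_integral_pull_volume_gain q hH.degree_pos, ← hE] at hreciprocal
  have hD : D ≤ 2 / I.ncard * X := by
    rw [div_mul_eq_mul_div, le_div_iff₀ hn]
    linarith [hH.le_volume I]
  simp only [transition, weight_pull]
  calc _ ≤ 1 / (X + τ * E) + τ ^ 2 * (D * E) / X ^ 3 := hreciprocal
    _ ≤ 1 / (X + τ * E) + τ ^ 2 * (2 / I.ncard * X * E) / X ^ 3 := by gcongr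
    _ = _ := by
        rw [← mul_div_assoc (q : ℝ), ← hE]
        field_simp

theorem transition_pull_inv_volume_le_of_le_half (hH : WellSpread H D θ c) (hc : 0 ≤ c)
    {I : Set V} (hI : I.Nonempty) (hI2 : (I.ncard : ℝ) ≤ Fintype.card V / 2) :
    transition pull (roundMeasure H q) (fun J => 1 / weight (H.degree ·) J) I ≤
      (1 - q * c / 16) * (1 / weight (H.degree ·) I) := by
  have hX := hH.volume_pos hI
  -- With `τ = 1 / 8` the drift beats the variance even for a single informed vertex.
  refine (hH.transition_pull_inv_volume_le q (τ := 1 / 8) (by norm_num) (by norm_num) hI).trans ?_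
  set m := (q : ℝ) * (weight (degIn H Iᶜ) I / weight (H.degree ·) I) with hm
  have hq := q.2.1
  have hm_ge : q * c ≤ m := by
    rw [hm]
    gcongr
    rw [le_div_iff₀ hX]
    exact hH.mul_volume_le_boundary_of_le_half hc hI2
  have hm0 : 0 ≤ m := (mul_nonneg hq hc).trans hm_ge
  have hm1 : m ≤ 1 := mul_le_one₀ q.2.2
    (div_nonneg (weight_nonneg (degIn_nonneg H _) I) hX.le)
    ((div_le_one hX).2 (weight_degIn_compl_le_volume H I))
  have hdrift : 1 / (1 + 1 / 8 * m) ≤ 1 - 3 / 32 * m := by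
    rw [div_le_iff₀ (by linarith)]
    nlinarith
  have hvar : (1 / 8 : ℝ) ^ 2 * (2 / I.ncard) * m ≤ 1 / 32 * m := by
    have : 2 / (I.ncard : ℝ) ≤ 2 := div_le_self zero_le_two (one_le_ncard hI)
    gcongr
    linarith
  gcongr
  linarith

theorem transition_pull_inv_volume_le_of_small (hH : WellSpread H D θ c) {K : ℝ} (hK : 0 < K)
    (hκ : 0 ≤ κ) (hκθ : 2 * (κ + θ) ≤ 1) {I : Set V} (hI : K ≤ I.ncard)
    (hI2 : (I.ncard : ℝ) ≤ κ * Fintype.card V) :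
    transition pull (roundMeasure H q) (fun J => 1 / weight (H.degree ·) J) I ≤
      (1 / (1 + q * (1 - 2 * (κ + θ))) + 2 / K) * (1 / weight (H.degree ·) I) := by
  have hne : I.Nonempty := Set.nonempty_of_ncard_ne_zero (Nat.cast_pos.1 (hK.trans_le hI)).ne'
  have hX := hH.volume_pos hne
  refine (hH.transition_pull_inv_volume_le q zero_le_one le_rfl hne).trans ?_
  set p := weight (degIn H Iᶜ) I / weight (H.degree ·) I
  have hq := q.2.1
  have hp : 1 - 2 * (κ + θ) ≤ p :=
    (le_div_iff₀ hX).2 (hH.mul_volume_le_boundary_of_small hκ hI2)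
  have hp0 : 0 ≤ p := (sub_nonneg.2 hκθ).trans hp
  have hp1 : p ≤ 1 := (div_le_one hX).2 (weight_degIn_compl_le_volume H I)
  have hvar : 2 / (I.ncard : ℝ) * (q * p) ≤ 2 / K :=
    (mul_le_of_le_one_right (by positivity) (mul_le_one₀ q.2.2 hp0 hp1)).trans (by gcongr)
  rw [one_mul, one_pow, one_mul]
  have : 0 ≤ (q : ℝ) * (1 - 2 * (κ + θ)) := mul_nonneg hq (sub_nonneg.2 hκθ)
  gcongr

theorem transition_pull_volume_compl_le (hH : WellSpread H D θ c) (hc : 0 ≤ c) (hκ : 0 ≤ κ)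
    (hκ1 : κ ≤ 1) {I : Set V} (hI : κ * Fintype.card V ≤ I.ncard) :
    transition pull (roundMeasure H q) (fun J => weight (H.degree ·) Jᶜ) I ≤
      (1 - q * c * κ) * weight (H.degree ·) Iᶜ := by
  rw [transition_pull_weight_compl q hH.degree_pos, ← sum_integral_pull_gain q hH.degree_pos,
    sum_integral_pull_volume_gain q hH.degree_pos]
  linarith [mul_le_mul_of_nonneg_left (hH.mul_volume_compl_le_boundary hc hκ hκ1 hI) q.2.1]

theorem transition_pull_ncard_compl_le (hH : WellSpread H D θ c) (hκ : 0 ≤ κ) {I : Set V}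
    (hI : (Iᶜ.ncard : ℝ) ≤ κ * Fintype.card V) :
    transition pull (roundMeasure H q) (fun J => (Jᶜ.ncard : ℝ)) I ≤
      (1 - q * (1 - 2 * (κ + θ))) * Iᶜ.ncard := by
  have hD := hH.pos
  have hfrac : ∀ u, 1 - 2 / D * degIn H Iᶜ u ≤ 1 * (degIn H I u / H.degree u) := fun u => by
    have hcompl : degIn H I u / H.degree u = 1 - degIn H Iᶜ u / H.degree u := by
      rw [degIn_compl, sub_div, div_self (hH.degree_pos u).ne']
      ring
    have hle : degIn H Iᶜ u / H.degree u ≤ degIn H Iᶜ u / (D / 2) :=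
      div_le_div_of_nonneg_left (degIn_nonneg H Iᶜ u) (half_pos hD) (hH.half_le_degree u)
    rw [one_mul, hcompl, div_mul_eq_mul_div, mul_comm, ← div_div_eq_mul_div]
    linarith
  have hinner : 2 / D * weight (degIn H Iᶜ) Iᶜ ≤ 2 * (κ + θ) * Iᶜ.ncard := by
    calc 2 / D * weight (degIn H Iᶜ) Iᶜ ≤ 2 / D * ((κ + θ) * D * Iᶜ.ncard) := by
          gcongr
          exact hH.inner_le_of_ncard_le hκ hI
      _ = _ := by field_simp
  have hgain : (1 - 2 * (κ + θ)) * Iᶜ.ncard ≤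
      weight (fun u => 1 * (degIn H I u / H.degree u)) Iᶜ := by
    refine le_trans ?_ (weight_mono hfrac _)
    rw [weight_sub, weight_const, weight_const_mul]
    linarith
  have hone : ∀ J : Set V, (J.ncard : ℝ) = weight (fun _ => 1) J := fun J => by
    rw [weight_const, one_mul]
  simp only [hone]
  rw [transition_pull_weight_compl q hH.degree_pos, ← hone]
  linarith [mul_le_mul_of_nonneg_left hgain q.2.1]

end WellSpread

end Pull

/-! ### One round of push&pull -/

section PushPull

theorem one_div_add_le_of_mul_le {a x y : ℝ} (hx : 0 < x) (ha : 0 ≤ a) (h : a * x ≤ y) :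
    1 / (x + y) ≤ 1 / (1 + a) * (1 / x) := by
  rw [one_div_mul_one_div, one_add_mul]
  gcongr

/-- The AM-GM inequality that makes `√d` the right weights for push&pull: pull along an edge `uv`
with `v` informed succeeds with probability `1 / d u` and push with probability `1 / d v`. -/
theorem two_div_sqrt_le {a b : ℝ} (ha : 0 < a) (hb : 0 < b) :
    2 * (1 / √b) ≤ √a * (1 / a + 1 / b) := by
  have := Real.sqrt_pos.2 ha
  have := Real.sqrt_pos.2 hb
  have hdiff : √a * (1 / √a ^ 2 + 1 / √b ^ 2) - 2 * (1 / √b) = (√a - √b) ^ 2 / (√a * √b ^ 2) := by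
    field_simp
    ring
  have : 0 ≤ (√a - √b) ^ 2 / (√a * b) := by positivity
  rw [Real.sq_sqrt ha.le, Real.sq_sqrt hb.le] at hdiff
  linarith

theorem pull_subset_pushPull {V : Type*} (ρ : Round V) (I : Set V) : pull ρ I ⊆ pushPull ρ I :=
  Set.subset_union_left

/-- The vertices that become informed by the call `x` of `v`, when `I` is the set of vertices
informed before. -/
def informedByCall {V : Type*} (I : Set V) (v : V) (x : V × Bool) : Set V :=
  {u | u ∉ I ∧ x.2 = true ∧ (u = v ∧ x.1 ∈ I ∨ u = x.1 ∧ v ∈ I)}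

theorem informedByCall_subsingleton {V : Type*} (I : Set V) (v : V) (x : V × Bool) :
    (informedByCall I v x).Subsingleton := by
  rintro u ⟨hu, -, hu'⟩ w ⟨-, -, hw'⟩
  grind

theorem chi_informedByCall {V : Type*} (I : Set V) (v : V) (x : V × Bool) (u : V) :
    chi (informedByCall I v x) u =
      chi Iᶜ u * (chi {u} v * chi (I ×ˢ {true}) x + chi I v * chi ({u} ×ˢ {true}) x) := by
  classical
  simp only [chi, informedByCall, Set.indicator_apply, Set.mem_ofPred_eq, Set.mem_compl_iff,
    Set.mem_prod, Set.mem_singleton_iff, Pi.one_apply]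
  grind

variable {V : Type*} [Fintype V]

theorem weight_informedByCall_le {s : V → ℝ} {b : ℝ} (hb : 0 ≤ b) (hs : ∀ u, s u ≤ b) (I : Set V)
    (v : V) (x : V × Bool) : weight s (informedByCall I v x) ≤ b := by
  have hcard : ((informedByCall I v x).ncard : ℝ) ≤ 1 := by
    exact_mod_cast Set.ncard_le_one_iff_subsingleton.2 (informedByCall_subsingleton I v x)
  refine (weight_mono hs _).trans ?_
  rw [weight_const]
  exact mul_le_of_le_one_right hb hcard

/-- The number of calls that inform the vertex `u`. -/
def hits (I : Set V) (ρ : Round V) (u : V) : ℝ := ∑ v, chi (informedByCall I v (ρ v)) u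

theorem sum_mul_hits (s : V → ℝ) (I : Set V) (ρ : Round V) :
    ∑ u, s u * hits I ρ u = ∑ v, weight s (informedByCall I v (ρ v)) := by
  simp only [hits, weight, Finset.mul_sum, mul_comm]
  exact Finset.sum_comm

theorem hits_le_sq (I : Set V) (ρ : Round V) (u : V) : hits I ρ u ≤ hits I ρ u ^ 2 :=
  calc hits I ρ u = ∑ v, chi (informedByCall I v (ρ v)) u ^ 2 := by simp only [chi_sq, hits]
    _ ≤ hits I ρ u ^ 2 := Finset.sum_sq_le_sq_sum_of_nonneg fun v _ => chi_nonneg _ _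

theorem hits_eq_zero {I : Set V} {ρ : Round V} {u : V} (h : u ∈ I ∨ u ∉ pushPull ρ I) :
    hits I ρ u = 0 := by
  refine Finset.sum_eq_zero fun v _ => chi_of_notMem ?_
  rintro ⟨hu, hx, ⟨rfl, hI⟩ | ⟨rfl, hI⟩⟩
  · exact h.elim hu fun hn => hn (.inl (.inr ⟨hI, hx⟩))
  · exact h.elim hu fun hn => hn (.inr ⟨v, hI, rfl, hx⟩)

/-- A Bonferroni inequality: counting hits overcounts the newly informed vertices only by pairs. -/
theorem le_chi_pushPull (ρ : Round V) (I : Set V) (u : V) :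
    chi I u + (2 * hits I ρ u - hits I ρ u ^ 2) ≤ chi (pushPull ρ I) u := by
  by_cases hu : u ∈ I
  · have hu' : u ∈ pushPull ρ I := .inl (.inl hu)
    simp [hits_eq_zero (.inl hu), chi_of_mem hu, chi_of_mem hu']
  by_cases hu' : u ∈ pushPull ρ I
  · rw [chi_of_notMem hu, chi_of_mem hu']
    linarith [sq_nonneg (hits I ρ u - 1)]
  · simp [hits_eq_zero (.inr hu'), chi_of_notMem hu, chi_of_notMem hu']

variable [MeasurableSpace V]

/-- The expected number of calls that inform the vertex `u`. -/
def expectedHits (H : SimpleGraph V) [DecidableRel H.Adj] (q : unitInterval) (I : Set V) (u : V) :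
    ℝ := ∫ ρ, hits I ρ u ∂(roundMeasure H q)

variable {H : SimpleGraph V} [DecidableRel H.Adj] (q : unitInterval)

theorem expectedHits_nonneg (I : Set V) (u : V) : 0 ≤ expectedHits H q I u :=
  integral_nonneg fun _ => Finset.sum_nonneg fun _ _ => chi_nonneg _ _

variable [MeasurableSingletonClass V]

theorem expectedHits_eq_sum (I : Set V) (u : V) :
    expectedHits H q I u = ∑ v, ∫ x, chi (informedByCall I v x) u ∂(callMeasure H q v) :=
  integral_pi_sum fun v x => chi (informedByCall I v x) u

theorem integral_sq_hits_le (I : Set V) (u : V) :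
    ∫ ρ, hits I ρ u ^ 2 ∂(roundMeasure H q) ≤ expectedHits H q I u ^ 2 + expectedHits H q I u := by
  have h := integral_sq_pi_sum_le (μ := callMeasure H q) fun v x => chi (informedByCall I v x) u
  simp only [chi_sq, ← expectedHits_eq_sum] at h
  exact h

theorem sum_integral_weight_informedByCall (s : V → ℝ) (I : Set V) :
    ∑ v, ∫ x, weight s (informedByCall I v x) ∂(callMeasure H q v) =
      ∑ u, s u * expectedHits H q I u := by
  rw [← integral_pi_sum]
  simp only [← sum_mul_hits, expectedHits, ← integral_const_mul]
  exact integral_finsetSum _ fun _ _ => .of_finite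

theorem integral_sum_mul_sq_hits_sub_le {s : V → ℝ} {b : ℝ} (hs : ∀ u, 0 ≤ s u)
    (hb : ∀ u, s u ≤ b) (I : Set V) :
    ∫ ρ, ∑ u, s u * (hits I ρ u ^ 2 - hits I ρ u) ∂(roundMeasure H q) ≤
      b * ∑ u, expectedHits H q I u ^ 2 := by
  rw [integral_finsetSum _ fun _ _ => .of_finite, Finset.mul_sum]
  refine Finset.sum_le_sum fun u _ => ?_
  rw [integral_const_mul, integral_sub .of_finite .of_finite]
  calc _ ≤ s u * expectedHits H q I u ^ 2 :=
        mul_le_mul_of_nonneg_left (sub_le_iff_le_add.2 (integral_sq_hits_le q I u)) (hs u)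
    _ ≤ b * expectedHits H q I u ^ 2 := mul_le_mul_of_nonneg_right (hb u) (sq_nonneg _)

theorem transition_pushPull_inv_weight_le {s : V → ℝ} {b : ℝ} (hs : ∀ u, 0 ≤ s u)
    (hb : ∀ u, s u ≤ b) {I : Set V} (hI : 0 < weight s I) :
    transition pushPull (roundMeasure H q) (fun J => 1 / weight s J) I ≤
      1 / (weight s I + ∑ u, s u * expectedHits H q I u) +
        b * (∑ u, s u * expectedHits H q I u) / weight s I ^ 3 +
        b * (∑ u, expectedHits H q I u ^ 2) / weight s I ^ 2 := by
  obtain ⟨u₀⟩ : Nonempty V := by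
    by_contra h
    simp [weight, not_nonempty_iff.1 h] at hI
  have hb0 : 0 ≤ b := (hs u₀).trans (hb u₀)
  have hgain : ∀ v x, 0 ≤ weight s (informedByCall I v x) := fun _ _ => weight_nonneg hs _
  have hpushPull : ∀ ρ, ∑ v, weight s (informedByCall I v (ρ v)) ≤
      (weight s (pushPull ρ I) - weight s I) + ∑ u, s u * (hits I ρ u ^ 2 - hits I ρ u) := by
    intro ρ
    rw [← sum_mul_hits]
    simp only [weight, ← Finset.sum_sub_distrib, ← Finset.sum_add_distrib]
    refine Finset.sum_le_sum fun u _ => ?_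
    linarith [mul_le_mul_of_nonneg_right (le_chi_pushPull ρ I u) (hs u)]
  have hreciprocal := integral_one_div_add_le (μ := roundMeasure H q) hI
    (fun ρ => sub_nonneg.2
      (weight_mono_set hs ((subset_pull ρ I).trans (pull_subset_pushPull ρ I))))
    (fun ρ => Finset.sum_nonneg fun v _ => hgain v (ρ v))
    (fun ρ => Finset.sum_nonneg fun u _ =>
      mul_nonneg (hs u) (sub_nonneg.2 (hits_le_sq I ρ u))) hpushPull
  have hvar := variance_pi_sum_le_mul (μ := callMeasure H q) hgain
    (weight_informedByCall_le hb0 hb I)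
  simp only [add_sub_cancel] at hreciprocal
  rw [roundMeasure_eq, integral_pi_sum fun v x => weight s (informedByCall I v x)] at hreciprocal
  rw [sum_integral_weight_informedByCall] at hreciprocal hvar
  refine hreciprocal.trans ?_
  gcongr
  exact integral_sum_mul_sq_hits_sub_le q hs hb I

theorem expectedHits_eq (hdeg : ∀ u, (0 : ℝ) < H.degree u) (I : Set V) (u : V) :
    expectedHits H q I u =
      q * (chi Iᶜ u * ∑ v, H.adjMatrix ℝ u v * chi I v * (1 / H.degree u + 1 / H.degree v)) := by
  have hcall : ∀ v, ∫ x, chi (informedByCall I v x) u ∂(callMeasure H q v) =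
      q * chi Iᶜ u * (chi {u} v * (degIn H I v / H.degree v) +
        H.adjMatrix ℝ u v * chi I v * (1 / H.degree v)) := fun v => by
    simp only [chi_informedByCall]
    rw [integral_const_mul, integral_add .of_finite .of_finite, integral_const_mul,
      integral_const_mul, integral_chi_callMeasure H q (hdeg v),
      integral_chi_callMeasure H q (hdeg v), degIn_singleton,
      (H.isSymm_adjMatrix (α := ℝ)).apply u v]
    ring
  simp only [expectedHits_eq_sum, hcall, ← Finset.mul_sum, Finset.sum_add_distrib]
  change q * chi Iᶜ u * (weight (fun v => degIn H I v / H.degree v) {u} + _) = _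
  rw [weight_singleton, degIn, Finset.sum_div, ← Finset.sum_add_distrib, mul_assoc]
  congr 2
  exact Finset.sum_congr rfl fun v _ => by ring

theorem le_sum_sqrt_mul_expectedHits (hdeg : ∀ u, (0 : ℝ) < H.degree u) (I : Set V) :
    q * (2 * weight (fun v => degIn H Iᶜ v * (1 / √(H.degree v))) I) ≤
      ∑ u, √(H.degree u) * expectedHits H q I u := by
  have hq := q.2.1
  calc q * (2 * weight (fun v => degIn H Iᶜ v * (1 / √(H.degree v))) I)
      = q * ∑ v, ∑ u, chi Iᶜ u * (H.adjMatrix ℝ u v * chi I v * (2 * (1 / √(H.degree v)))) := by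
        simp only [weight, degIn, Finset.mul_sum, Finset.sum_mul]
        refine Finset.sum_congr rfl fun v _ => Finset.sum_congr rfl fun u _ => ?_
        rw [(H.isSymm_adjMatrix (α := ℝ)).apply u v]
        ring
    _ ≤ q * ∑ v, ∑ u, chi Iᶜ u * (H.adjMatrix ℝ u v * chi I v *
          (√(H.degree u) * (1 / H.degree u + 1 / H.degree v))) := by
        have hedge : ∀ u v, 0 ≤ H.adjMatrix ℝ u v * chi I v := fun u v =>
          mul_nonneg (adjMatrix_nonneg H u v) (chi_nonneg I v)
        gcongr q * ∑ v, ∑ u, ?_ with v _ u _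
        exact mul_le_mul_of_nonneg_left
          (mul_le_mul_of_nonneg_left (two_div_sqrt_le (hdeg u) (hdeg v)) (hedge u v))
          (chi_nonneg _ _)
    _ = _ := by
        rw [Finset.sum_comm, Finset.mul_sum]
        refine Finset.sum_congr rfl fun u _ => ?_
        rw [expectedHits_eq q hdeg]
        simp only [Finset.mul_sum]
        exact Finset.sum_congr rfl fun v _ => by ring

namespace WellSpread

variable {D θ c κ : ℝ}

theorem expectedHits_le (hH : WellSpread H D θ c) (I : Set V) (u : V) :
    expectedHits H q I u ≤ 4 / D * (chi Iᶜ u * degIn H I u) := by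
  have hD := hH.pos
  have hedge : ∀ v, 0 ≤ H.adjMatrix ℝ u v * chi I v := fun v =>
    mul_nonneg (adjMatrix_nonneg H u v) (chi_nonneg I v)
  have hinv : ∀ v, 1 / (H.degree v : ℝ) ≤ 2 / D := fun v => by
    rw [div_le_div_iff₀ (hH.degree_pos v) hD]
    linarith [hH.half_le_degree v]
  have hsum : ∑ v, H.adjMatrix ℝ u v * chi I v * (1 / H.degree u + 1 / H.degree v) ≤
      4 / D * degIn H I u := by
    rw [degIn, mul_comm, Finset.sum_mul]
    refine Finset.sum_le_sum fun v _ => mul_le_mul_of_nonneg_left ?_ (hedge v)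
    calc 1 / (H.degree u : ℝ) + 1 / H.degree v ≤ 2 / D + 2 / D := add_le_add (hinv u) (hinv v)
      _ = 4 / D := by ring
  have hsum0 : 0 ≤ ∑ v, H.adjMatrix ℝ u v * chi I v * (1 / H.degree u + 1 / H.degree v) :=
    Finset.sum_nonneg fun v _ => mul_nonneg (hedge v) (by positivity)
  rw [expectedHits_eq q hH.degree_pos, mul_left_comm (4 / D)]
  exact (mul_le_of_le_one_left (mul_nonneg (chi_nonneg _ _) hsum0) q.2.2).trans
    (mul_le_mul_of_nonneg_left hsum (chi_nonneg _ _))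

theorem sum_mul_expectedHits_le (hH : WellSpread H D θ c) {s : V → ℝ} {b : ℝ} (hb0 : 0 ≤ b)
    (hb : ∀ u, s u ≤ b) (I : Set V) :
    ∑ u, s u * expectedHits H q I u ≤ 4 * b * I.ncard := by
  have hD := hH.pos
  calc ∑ u, s u * expectedHits H q I u ≤ ∑ u, b * (4 / D * (chi Iᶜ u * degIn H I u)) :=
        Finset.sum_le_sum fun u _ =>
          mul_le_mul (hb u) (hH.expectedHits_le q I u) (expectedHits_nonneg q I u) hb0
    _ = b * (4 / D * weight (degIn H Iᶜ) I) := by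
        rw [weight_degIn_symm, weight, Finset.mul_sum, Finset.mul_sum]
    _ ≤ b * (4 / D * (D * I.ncard)) := by
        gcongr
        exact (weight_degIn_compl_le_volume H I).trans (hH.volume_le I)
    _ = 4 * b * I.ncard := by field_simp

theorem sum_sq_expectedHits_le (hH : WellSpread H D θ c) (hκ : 0 ≤ κ) {I : Set V}
    (hI : (I.ncard : ℝ) ≤ κ * Fintype.card V) :
    ∑ u, expectedHits H q I u ^ 2 ≤ 32 * (κ + θ) * I.ncard := by
  have hD := hH.pos
  have hle : ∀ u, expectedHits H q I u ≤ 4 / D * degIn H I u := fun u =>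
    (hH.expectedHits_le q I u).trans (mul_le_mul_of_nonneg_left
      (mul_le_of_le_one_left (degIn_nonneg H I u) (chi_le_one _ _)) (by positivity))
  calc ∑ u, expectedHits H q I u ^ 2 ≤ ∑ u, (4 / D * degIn H I u) ^ 2 :=
        Finset.sum_le_sum fun u _ => pow_le_pow_left₀ (expectedHits_nonneg q I u) (hle u) 2
    _ = (4 / D) ^ 2 * ∑ u, degIn H I u ^ 2 := by simp only [mul_pow, Finset.mul_sum]
    _ ≤ (4 / D) ^ 2 * (2 * (κ + θ) * D ^ 2 * I.ncard) := by
        gcongr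
        refine (hH.sum_sq_le I).trans ?_
        gcongr
        exact div_le_of_le_mul₀ (Nat.cast_nonneg _) hκ hI
    _ = 32 * (κ + θ) * I.ncard := by
        field_simp
        ring

theorem mul_weight_sqrt_le_sum_mul_expectedHits (hH : WellSpread H D θ c) (hκ : 0 ≤ κ)
    {I : Set V} (hI : (I.ncard : ℝ) ≤ κ * Fintype.card V) :
    2 * q * (1 - 4 * (κ + θ)) * weight (fun u => √(H.degree u)) I ≤
      ∑ u, √(H.degree u) * expectedHits H q I u := by
  have hsD : 0 < √D := Real.sqrt_pos.2 hH.pos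
  have hκθ : 0 ≤ κ + θ := add_nonneg hκ hH.error_nonneg
  have hout : ∀ u, √(H.degree u) - 2 / √D * degIn H I u ≤ degIn H Iᶜ u * (1 / √(H.degree u)) := by
    intro u
    have hinv : 1 / √(H.degree u) ≤ 2 / √D := by
      rw [div_le_div_iff₀ (Real.sqrt_pos.2 (hH.degree_pos u)) hsD, one_mul]
      exact hH.sqrt_le_two_mul_sqrt_degree u
    rw [degIn_compl, sub_mul, mul_one_div, Real.div_sqrt]
    linarith [mul_le_mul_of_nonneg_right hinv (degIn_nonneg H I u)]
  have hinner : 2 / √D * weight (degIn H I) I ≤ 4 * (κ + θ) * weight (fun u => √(H.degree u)) I :=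
    calc 2 / √D * weight (degIn H I) I ≤ 2 / √D * ((κ + θ) * D * I.ncard) := by
          gcongr
          exact hH.inner_le_of_ncard_le hκ hI
      _ = 2 * (κ + θ) * (√D * I.ncard) := by
          nth_rw 2 [← Real.sq_sqrt hH.pos.le]
          field_simp
      _ ≤ 2 * (κ + θ) * (2 * weight (fun u => √(H.degree u)) I) := by
          gcongr 2 * (κ + θ) * ?_
          exact hH.sqrt_mul_ncard_le I
      _ = _ := by ring
  have hboundary := weight_mono hout I
  rw [weight_sub, weight_const_mul] at hboundary
  refine le_trans ?_ (le_sum_sqrt_mul_expectedHits q hH.degree_pos I)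
  rw [mul_comm 2 (q : ℝ), mul_assoc, mul_assoc]
  refine mul_le_mul_of_nonneg_left ?_ q.2.1
  linarith

theorem transition_pushPull_inv_weight_sqrt_le_of_small (hH : WellSpread H D θ c) {K : ℝ}
    (hK : 0 < K) (hκ : 0 ≤ κ) (hκθ : 4 * (κ + θ) ≤ 1) {I : Set V} (hI : K ≤ I.ncard)
    (hI2 : (I.ncard : ℝ) ≤ κ * Fintype.card V) :
    transition pushPull (roundMeasure H q) (fun J => 1 / weight (fun u => √(H.degree u)) J) I ≤
      (1 / (1 + 2 * q * (1 - 4 * (κ + θ))) + 16 / K + 64 * (κ + θ)) *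
        (1 / weight (fun u => √(H.degree u)) I) := by
  have hD := Real.sqrt_pos.2 hH.pos
  have hn : (0 : ℝ) < I.ncard := hK.trans_le hI
  have hκθ0 : 0 ≤ κ + θ := add_nonneg hκ hH.error_nonneg
  have hq := q.2.1
  have hs : ∀ u, √(H.degree u) ≤ √D := fun u => Real.sqrt_le_sqrt (hH.degree_le u)
  set W := weight (fun u => √(H.degree u)) I
  set M := ∑ u, √(H.degree u) * expectedHits H q I u
  have hDW : √D * I.ncard ≤ 2 * W := hH.sqrt_mul_ncard_le I
  have hW : 0 < W := by linarith [mul_pos hD hn]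
  have hM : M ≤ 4 * √D * I.ncard := hH.sum_mul_expectedHits_le q hD.le hs I
  have hdrift : 1 / (W + M) ≤ 1 / (1 + 2 * q * (1 - 4 * (κ + θ))) * (1 / W) :=
    one_div_add_le_of_mul_le hW (mul_nonneg (mul_nonneg zero_le_two hq) (sub_nonneg.2 hκθ))
      (hH.mul_weight_sqrt_le_sum_mul_expectedHits q hκ hI2)
  have hvar : √D * M / W ^ 3 ≤ 16 / K * (1 / W) :=
    calc √D * M / W ^ 3 ≤ √D * (4 * √D * I.ncard) / W ^ 3 := by gcongr
      _ = 4 / I.ncard * ((√D * I.ncard) ^ 2 / W ^ 3) := by field_simp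
      _ ≤ 4 / K * ((2 * W) ^ 2 / W ^ 3) := by gcongr
      _ = 16 / K * (1 / W) := by
          field_simp
          ring
  have hcorr : √D * (∑ u, expectedHits H q I u ^ 2) / W ^ 2 ≤ 64 * (κ + θ) * (1 / W) :=
    calc _ ≤ √D * (32 * (κ + θ) * I.ncard) / W ^ 2 := by
          gcongr
          exact hH.sum_sq_expectedHits_le q hκ hI2
      _ = 32 * (κ + θ) * ((√D * I.ncard) / W ^ 2) := by ring
      _ ≤ 32 * (κ + θ) * (2 * W / W ^ 2) := by gcongr
      _ = 64 * (κ + θ) * (1 / W) := by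
          field_simp
          ring
  rw [add_mul, add_mul]
  exact (transition_pushPull_inv_weight_le q (fun u => Real.sqrt_nonneg _) hs hW).trans
    (add_le_add (add_le_add hdrift hvar) hcorr)

end WellSpread

end PushPull

/-! ### The phases of the process on a fixed graph -/

section Phases

variable {V : Type*} {P : Protocol V}

theorem mapsTo_univ (hP : ∀ ρ I, pull ρ I ⊆ P ρ I) (ρ : Round V) :
    Set.MapsTo (P ρ) {Set.univ} {Set.univ} := by
  rintro _ rfl
  exact Set.univ_subset_iff.1 ((subset_pull ρ _).trans (hP ρ _))

theorem mapsTo_le_ncard [Finite V] (hP : ∀ ρ I, pull ρ I ⊆ P ρ I) (a : ℝ) (ρ : Round V) :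
    Set.MapsTo (P ρ) {I | a ≤ I.ncard} {I | a ≤ I.ncard} := fun I (hI : a ≤ I.ncard) =>
  hI.trans (Nat.cast_le.2 (Set.ncard_le_ncard ((subset_pull ρ I).trans (hP ρ I))))

theorem mapsTo_ncard_compl_le [Finite V] (hP : ∀ ρ I, pull ρ I ⊆ P ρ I) (a : ℝ) (ρ : Round V) :
    Set.MapsTo (P ρ) {I | (Iᶜ.ncard : ℝ) ≤ a} {I | (Iᶜ.ncard : ℝ) ≤ a} :=
  fun I (hI : (Iᶜ.ncard : ℝ) ≤ a) => le_trans (Nat.cast_le.2 (Set.ncard_le_ncard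
    (Set.compl_subset_compl.2 ((subset_pull ρ I).trans (hP ρ I))))) hI

theorem ncard_le_card [Fintype V] (I : Set V) : I.ncard ≤ Fintype.card V :=
  Nat.card_eq_fintype_card (α := V) ▸ Set.ncard_le_card I

variable [Fintype V] [MeasurableSpace V] [MeasurableSingletonClass V]
  {H : SimpleGraph V} [DecidableRel H.Adj] {D θ c x β κ : ℝ}

/-- As long as the number of informed vertices is between `1 / x` and `x * n`, some vertex weight,
constant up to a factor `2`, satisfies: the mean of the reciprocal weight of the informed set
shrinks by a factor `β` in each round. -/
def Grows (H : SimpleGraph V) [DecidableRel H.Adj] (q : unitInterval) (P : Protocol V)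
    (x β : ℝ) : Prop :=
  ∃ (s : V → ℝ) (r : ℝ), 0 < r ∧ (∀ u, r ≤ s u) ∧ (∀ u, s u ≤ 2 * r) ∧
    ∀ I : Set V, 1 / x ≤ I.ncard → (I.ncard : ℝ) ≤ x * Fintype.card V →
      transition P (roundMeasure H q) (fun J => 1 / weight s J) I ≤ β * (1 / weight s I)

variable (q : unitInterval)

theorem WellSpread.grows_pull (hH : WellSpread H D x c) (hx : 0 < x) (hx4 : 4 * x ≤ 1) :
    Grows H q pull x (1 / (1 + q * (1 - 4 * x)) + 2 * x) := by
  refine ⟨(H.degree ·), D / 2, by linarith [hH.pos], hH.half_le_degree,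
    fun u => by linarith [hH.degree_le u], fun I hI hI2 => ?_⟩
  convert hH.transition_pull_inv_volume_le_of_small q (by positivity) hx.le (by linarith) hI hI2
    using 2
  field_simp
  ring

theorem WellSpread.grows_pushPull (hH : WellSpread H D x c) (hx : 0 < x) (hx8 : 8 * x ≤ 1) :
    Grows H q pushPull x (1 / (1 + 2 * q * (1 - 8 * x)) + 144 * x) := by
  have hD := hH.pos
  refine ⟨fun u => √(H.degree u), √(D / 2), Real.sqrt_pos.2 (by linarith),
    fun u => Real.sqrt_le_sqrt (hH.half_le_degree u), fun u => ?_, fun I hI hI2 => ?_⟩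
  · refine Real.sqrt_le_iff.2 ⟨by positivity, (hH.degree_le u).trans ?_⟩
    rw [mul_pow, Real.sq_sqrt (by linarith)]
    linarith
  · have hstep := hH.transition_pushPull_inv_weight_sqrt_le_of_small q (K := 1 / x)
      (by positivity) hx.le (by linarith) hI hI2
    convert hstep using 2
    rw [div_div_eq_mul_div, div_one, add_assoc]
    ring_nf

theorem WellSpread.transition_iterate_ncard_lt_le (hP : ∀ ρ I, pull ρ I ⊆ P ρ I)
    (hH : WellSpread H D θ c) (hc : 0 ≤ c) (hc1 : c ≤ 1) {K : ℝ} (hK : 0 < K)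
    (hKn : K ≤ Fintype.card V / 2) (t : ℕ) (v : V) :
    (transition P (roundMeasure H q))^[t] (chi {I | K ≤ I.ncard}ᶜ) {v} ≤
      (1 - q * c / 16) ^ t * (2 * K) := by
  have hD := hH.pos
  have hβ : 0 ≤ 1 - q * c / 16 := by linarith [mul_le_one₀ q.2.2 hc hc1]
  have hdeg : ∀ u, (0 : ℝ) ≤ H.degree u := fun u => (hH.degree_pos u).le
  have hne : ∀ ρ, Set.MapsTo (P ρ) {I | I.Nonempty} {I | I.Nonempty} := fun ρ I hI =>
    Set.Nonempty.mono ((subset_pull ρ I).trans (hP ρ I)) hI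
  refine (transition_iterate_chi_compl_le (h := fun J => 1 / weight (H.degree ·) J)
    (m := 1 / (D * K)) hne (mapsTo_le_ncard hP K) hβ (by positivity)
    (fun I => one_div_nonneg.2 (weight_nonneg hdeg I)) (fun I hI hIK => ?_) (fun I hI hIK => ?_) t
    (Set.singleton_nonempty v)).trans ?_
  · refine one_div_le_one_div_of_le (hH.volume_pos hI) ((hH.volume_le I).trans ?_)
    gcongr
    exact (not_le.1 hIK).le
  · refine (transition_le_transition fun ρ => ?_).trans
      (hH.transition_pull_inv_volume_le_of_le_half q hc hI ((not_le.1 hIK).le.trans hKn))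
    exact one_div_le_one_div_of_le (hH.volume_pos (Set.Nonempty.mono (subset_pull ρ I) hI))
      (weight_mono_set hdeg (hP ρ I))
  · gcongr
    rw [weight_singleton, div_div_eq_mul_div, div_one, div_mul_eq_mul_div, one_mul,
      div_le_iff₀ (hH.degree_pos v)]
    linarith [mul_le_mul_of_nonneg_left (hH.half_le_degree v) hK.le]

theorem Grows.transition_iterate_ncard_lt_le (hP : ∀ ρ I, pull ρ I ⊆ P ρ I)
    (hgr : Grows H q P x β) (hβ : 0 ≤ β) (hx : 0 < x) (hx1 : x ≤ 1) (t : ℕ) {I : Set V}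
    (hI : 1 / x ≤ I.ncard) :
    (transition P (roundMeasure H q))^[t] (chi {J | x * Fintype.card V ≤ J.ncard}ᶜ) I ≤
      β ^ t * (2 * Fintype.card V) := by
  obtain ⟨s, r, hr, hs, hs2, hdrift⟩ := hgr
  have hone : 1 ≤ 1 / x := one_le_one_div hx hx1
  have hlow : ∀ J : Set V, r * J.ncard ≤ weight s J := fun J => by
    rw [← weight_const]
    exact weight_mono hs J
  have hupp : ∀ J : Set V, weight s J ≤ 2 * r * Fintype.card V := fun J => by
    refine (weight_mono hs2 J).trans ?_
    rw [weight_const]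
    gcongr
    exact ncard_le_card J
  have hr_le : ∀ J : Set V, 1 / x ≤ J.ncard → r ≤ weight s J := fun J hJ =>
    (le_mul_of_one_le_right hr.le (hone.trans hJ)).trans (hlow J)
  have hn : (0 : ℝ) < Fintype.card V := by linarith [Nat.cast_le (α := ℝ).2 (ncard_le_card I)]
  refine (transition_iterate_chi_compl_le (h := fun J => 1 / weight s J)
    (m := 1 / (2 * r * Fintype.card V)) (mapsTo_le_ncard hP (1 / x))
    (mapsTo_le_ncard hP (x * Fintype.card V)) hβ (by positivity)
    (fun J => one_div_nonneg.2 (weight_nonneg (fun u => hr.le.trans (hs u)) J))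
    (fun J hJ _ => one_div_le_one_div_of_le (hr.trans_le (hr_le J hJ)) (hupp J))
    (fun J hJ hJx => hdrift J hJ (not_le.1 hJx).le) t hI).trans ?_
  gcongr
  rw [div_div_eq_mul_div, div_one, div_mul_eq_mul_div, one_mul,
    div_le_iff₀ (hr.trans_le (hr_le I hI))]
  linarith [mul_le_mul_of_nonneg_left (hr_le I hI) hn.le]

theorem WellSpread.transition_iterate_lt_ncard_compl_le (hP : ∀ ρ I, pull ρ I ⊆ P ρ I)
    (hH : WellSpread H D θ c) (hc : 0 ≤ c) (hc1 : c ≤ 1) (hκ : 0 < κ) (hκ1 : κ ≤ 1)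
    (hn : (0 : ℝ) < Fintype.card V) (t : ℕ) {I : Set V} (hI : κ * Fintype.card V ≤ I.ncard) :
    (transition P (roundMeasure H q))^[t] (chi {J | (Jᶜ.ncard : ℝ) ≤ κ * Fintype.card V}ᶜ) I ≤
      (1 - q * c * κ) ^ t * (2 / κ) := by
  have hD := hH.pos
  have hβ : 0 ≤ 1 - q * c * κ :=
    sub_nonneg.2 (mul_le_one₀ (mul_le_one₀ q.2.2 hc hc1) hκ.le hκ1)
  have hdeg : ∀ u, (0 : ℝ) ≤ H.degree u := fun u => (hH.degree_pos u).le
  refine (transition_iterate_chi_compl_le (h := fun J => weight (H.degree ·) Jᶜ)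
    (m := D / 2 * (κ * Fintype.card V)) (mapsTo_le_ncard hP (κ * Fintype.card V))
    (mapsTo_ncard_compl_le hP (κ * Fintype.card V)) hβ (by positivity)
    (fun J => weight_nonneg hdeg _) (fun J _ hJκ => ?_) (fun J hJ _ => ?_) t hI).trans ?_
  · refine le_trans ?_ (hH.le_volume Jᶜ)
    gcongr
    exact (not_le.1 hJκ).le
  · refine (transition_le_transition fun ρ => ?_).trans
      (hH.transition_pull_volume_compl_le q hc hκ.le hκ1 hJ)
    exact weight_mono_set hdeg (Set.compl_subset_compl.2 (hP ρ J))
  · refine mul_le_mul_of_nonneg_left ?_ (pow_nonneg hβ t)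
    rw [div_le_div_iff₀ (by positivity) hκ]
    calc weight (H.degree ·) Iᶜ * κ ≤ D * Fintype.card V * κ := by
          gcongr
          exact (hH.volume_le _).trans (by gcongr; exact ncard_le_card _)
      _ = _ := by ring

theorem WellSpread.transition_iterate_ne_univ_le_of_ncard_compl_le
    (hP : ∀ ρ I, pull ρ I ⊆ P ρ I) (hH : WellSpread H D θ c) (hκ : 0 ≤ κ) (t : ℕ) {I : Set V}
    (hI : (Iᶜ.ncard : ℝ) ≤ κ * Fintype.card V) :
    (transition P (roundMeasure H q))^[t] (chi {Set.univ}ᶜ) I ≤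
      (1 - q * (1 - 2 * (κ + θ))) ^ t * Fintype.card V := by
  have hβ : 0 ≤ 1 - q * (1 - 2 * (κ + θ)) := by
    linarith [q.2.2, mul_nonneg q.2.1 (add_nonneg hκ hH.error_nonneg)]
  refine (transition_iterate_chi_compl_le (h := fun J : Set V => (Jᶜ.ncard : ℝ)) (m := 1)
    (mapsTo_ncard_compl_le hP (κ * Fintype.card V)) (mapsTo_univ hP) hβ one_pos
    (fun J => Nat.cast_nonneg _) (fun J _ hJ => one_le_ncard (Set.nonempty_compl.2 hJ))
    (fun J hJ _ => ?_) t hI).trans ?_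
  · refine (transition_le_transition fun ρ => ?_).trans (hH.transition_pull_ncard_compl_le q hκ hJ)
    exact Nat.cast_le.2 (Set.ncard_le_ncard (Set.compl_subset_compl.2 (hP ρ J)))
  · rw [div_one]
    gcongr
    exact ncard_le_card _

theorem WellSpread.transition_iterate_ne_univ_le (hP : ∀ ρ I, pull ρ I ⊆ P ρ I)
    (hH : WellSpread H D x c) (hc : 0 ≤ c) (hc1 : c ≤ 1) (hgr : Grows H q P x β) (hβ : 0 ≤ β)
    (hx : 0 < x) (hx1 : x ≤ 1) (hn : 2 / x ≤ Fintype.card V) (t₀ t₁ t₂ t₃ : ℕ) (v : V) :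
    (transition P (roundMeasure H q))^[t₀ + (t₁ + (t₂ + t₃))] (chi {Set.univ}ᶜ) {v} ≤
      (1 - q * c / 16) ^ t₀ * (2 / x) + (β ^ t₁ * (2 * Fintype.card V) +
        ((1 - q * c * x) ^ t₂ * (2 / x) + (1 - q * (1 - 4 * x)) ^ t₃ * Fintype.card V)) := by
  have hn0 : (0 : ℝ) < Fintype.card V := lt_of_lt_of_le (by positivity) hn
  have hmiddle : (0 : ℝ) ≤ 1 - q * c * x :=
    sub_nonneg.2 (mul_le_one₀ (mul_le_one₀ q.2.2 hc hc1) hx.le hx1)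
  have hfinish : (0 : ℝ) ≤ 1 - q * (1 - 4 * x) := by linarith [q.2.2, mul_nonneg q.2.1 hx.le]
  have htwo : 2 / x = 2 * (1 / x) := by ring
  rw [htwo] at hn ⊢
  refine (transition_iterate_add_chi_le (A := {I | 1 / x ≤ I.ncard}) t₀ _ _ (by positivity)
    fun I hI => ?_).trans (add_le_add_left
      (hH.transition_iterate_ncard_lt_le q hP hc hc1 (by positivity) (by linarith) t₀ v) _)
  refine (transition_iterate_add_chi_le (A := {I | x * Fintype.card V ≤ I.ncard}) t₁ _ _
    (by positivity) fun J hJ => ?_).trans (add_le_add_left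
      (hgr.transition_iterate_ncard_lt_le q hP hβ hx hx1 t₁ hI) _)
  rw [← htwo]
  refine (transition_iterate_add_chi_le (A := {I | (Iᶜ.ncard : ℝ) ≤ x * Fintype.card V}) t₂ _ _
    (by positivity) fun L hL => ?_).trans (add_le_add_left
      (hH.transition_iterate_lt_ncard_compl_le q hP hc hc1 hx hx1 hn0 t₂ hJ) _)
  convert hH.transition_iterate_ne_univ_le_of_ncard_compl_le q hP hx.le t₃ hL using 5
  ring

theorem WellSpread.transition_iterate_pull_half_le (hH : WellSpread H D θ c) (t : ℕ) (v : V) :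
    (transition pull (roundMeasure H q))^[t] (chi {I | (I.ncard : ℝ) < Fintype.card V / 2}ᶜ) {v} ≤
      4 * ((1 + q) ^ t / Fintype.card V) := by
  have hD := hH.pos
  have hq := q.2.1
  have : Nonempty V := ⟨v⟩
  have hmarkov : ∀ I : Set V, chi {I | (I.ncard : ℝ) < Fintype.card V / 2}ᶜ I ≤
      4 / (D * Fintype.card V) * weight (H.degree ·) I := fun I => by
    by_cases hI : (I.ncard : ℝ) < Fintype.card V / 2
    · have := weight_nonneg (fun u => (hH.degree_pos u).le) I
      rw [chi_of_notMem (not_not.2 hI)]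
      positivity
    · rw [chi_of_mem hI, div_mul_eq_mul_div, le_div_iff₀ (by positivity)]
      linarith [hH.le_volume I, mul_le_mul_of_nonneg_left (not_lt.1 hI) hD.le]
  refine (transition_iterate_mono t hmarkov {v}).trans ((transition_iterate_le_pow_mul
    (R := Set.univ) (β := 1 + q) (fun _ _ _ => trivial) (by positivity) (fun I _ => ?_) t
    trivial).trans ?_)
  · calc transition pull (roundMeasure H q)
          (fun I => 4 / (D * Fintype.card V) * weight (H.degree ·) I) I
        = 4 / (D * Fintype.card V) *
            transition pull (roundMeasure H q) (weight (H.degree ·)) I := integral_const_mul _ _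
      _ ≤ 4 / (D * Fintype.card V) * ((1 + q) * weight (H.degree ·) I) := by
          gcongr
          exact transition_pull_volume_le q hH.degree_pos I
      _ = _ := by ring
  · rw [weight_singleton]
    calc (1 + q : ℝ) ^ t * (4 / (D * Fintype.card V) * H.degree v)
        ≤ (1 + q : ℝ) ^ t * (4 / (D * Fintype.card V) * D) := by
          gcongr
          exact hH.degree_le v
      _ = _ := by field_simp

theorem WellSpread.transition_iterate_pull_univ_le (hH : WellSpread H D θ c) (s t : ℕ) (v : V) :
    (transition pull (roundMeasure H q))^[s + t] (chi {Set.univ}) {v} ≤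
      4 * ((1 + q) ^ s / Fintype.card V) + Real.exp (-((1 - q) ^ t * Fintype.card V / 2)) := by
  refine (transition_iterate_add_chi_le (A := {I | (I.ncard : ℝ) < Fintype.card V / 2}) s t _
    (Real.exp_nonneg _) fun I (hI : (I.ncard : ℝ) < _) => ?_).trans
    (add_le_add_left (hH.transition_iterate_pull_half_le q s v) _)
  refine (RumorSpreading.transition_iterate_pull_univ_le q hH.degree_pos t I).trans
    (Real.exp_le_exp.2 (neg_le_neg ?_))
  rw [mul_div_assoc]
  refine mul_le_mul_of_nonneg_left ?_ (pow_nonneg (sub_nonneg.2 q.2.2) t)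
  rw [ncard_compl_eq]
  linarith

end Phases

/-! ### Runtimes -/

section Runtime

variable {V : Type*} {P : Protocol V}

theorem monotone_informed (hP : ∀ ρ I, I ⊆ P ρ I) (v : V) (ω : ℕ → Round V) :
    Monotone (informed P v ω) :=
  monotone_nat_of_le_succ fun t => hP (ω t) _

theorem informed_eq_univ_of_le (hP : ∀ ρ I, I ⊆ P ρ I) {v : V} {ω : ℕ → Round V} {s t : ℕ}
    (hst : s ≤ t) (h : informed P v ω s = Set.univ) : informed P v ω t = Set.univ :=
  Set.univ_subset_iff.1 (h ▸ monotone_informed hP v ω hst)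

theorem exists_runtime_eq {v : V} {ω : ℕ → Round V} {T : ℕ} (hT : informed P v ω T = Set.univ) :
    ∃ t : ℕ, runtime P v ω = t ∧ informed P v ω t = Set.univ ∧ t ≤ T := by
  classical
  have hex : ∃ t, informed P v ω t = Set.univ := ⟨T, hT⟩
  refine ⟨Nat.find hex, le_antisymm ?_ ?_, Nat.find_spec hex, Nat.find_min' hex hT⟩
  · exact iInf₂_le (f := fun (t : ℕ) (_ : informed P v ω t = Set.univ) => (t : ℕ∞)) _
      (Nat.find_spec hex)
  · exact le_iInf₂ fun t ht => Nat.cast_le.2 (Nat.find_min' hex ht)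

variable [Fintype V] [MeasurableSpace V] (H : SimpleGraph V) [DecidableRel H.Adj]
  (q : unitInterval)

instance : IsProbabilityMeasure (processMeasure H q) := by
  unfold processMeasure
  infer_instance

variable [MeasurableSingletonClass V] {s t : ℕ}

theorem measureReal_informed_ne_univ_le (hP : ∀ ρ I, I ⊆ P ρ I) (hst : s ≤ t) (v : V) :
    (processMeasure H q).real {ω | informed P v ω t ≠ Set.univ} ≤
      (transition P (roundMeasure H q))^[s] (chi {Set.univ}ᶜ) {v} :=
  (measureReal_mono (s₁ := {ω | informed P v ω t ≠ Set.univ})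
    fun _ hω hs => hω (informed_eq_univ_of_le hP hst hs)).trans_eq
    (measureReal_informed_mem P v (roundMeasure H q) s {Set.univ}ᶜ)

theorem measureReal_informed_eq_univ_le (hP : ∀ ρ I, I ⊆ P ρ I) (hst : s ≤ t) (v : V) :
    (processMeasure H q).real {ω | informed P v ω s = Set.univ} ≤
      (transition P (roundMeasure H q))^[t] (chi {Set.univ}) {v} :=
  (measureReal_mono fun _ hω => informed_eq_univ_of_le hP hst hω).trans_eq
    (measureReal_informed_mem P v (roundMeasure H q) t {Set.univ})

end Runtime

/-! ### Asymptotics in `log n` -/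

section Asymptotics

theorem tendsto_log_natCast : Tendsto (fun n : ℕ => Real.log n) atTop atTop :=
  Real.tendsto_log_atTop.comp tendsto_natCast_atTop_atTop

variable {a b : ℝ}

theorem tendsto_pow_ceil_log (hb : b ∈ Set.Ico 0 1) (ha : 0 < a) :
    Tendsto (fun n : ℕ => b ^ ⌈a * Real.log n⌉₊) atTop (𝓝 0) :=
  (tendsto_pow_atTop_nhds_zero_of_lt_one hb.1 hb.2).comp
    (tendsto_nat_ceil_atTop.comp (tendsto_log_natCast.const_mul_atTop ha))

theorem tendsto_pow_ceil_log_mul (hb : b ∈ Set.Ioc 0 1) (ha : a * Real.log b < -1) :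
    Tendsto (fun n : ℕ => b ^ ⌈a * Real.log n⌉₊ * (n : ℝ)) atTop (𝓝 0) := by
  have hlim : Tendsto (fun n : ℕ => Real.exp ((1 + a * Real.log b) * Real.log n)) atTop (𝓝 0) :=
    Real.tendsto_exp_atBot.comp (tendsto_log_natCast.const_mul_atTop_of_neg (by linarith))
  have hlogb : Real.log b ≤ 0 := Real.log_nonpos hb.1.le hb.2
  have hb0 := hb.1
  refine squeeze_zero' (Eventually.of_forall fun n => by positivity) ?_ hlim
  filter_upwards [eventually_gt_atTop 0] with n hn
  rw [add_mul, one_mul, Real.exp_add, Real.exp_log (Nat.cast_pos.2 hn), mul_comm]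
  gcongr
  rw [← Real.exp_log hb0, ← Real.exp_nat_mul, Real.log_exp, Real.exp_le_exp]
  linarith [mul_le_mul_of_nonpos_right (Nat.le_ceil (a * Real.log n)) hlogb]

theorem tendsto_pow_ceil_log_div (hb : 1 ≤ b) (hab : a * Real.log b < 1) :
    Tendsto (fun n : ℕ => b ^ ⌈a * Real.log n⌉₊ / (n : ℝ)) atTop (𝓝 0) := by
  have hb0 : 0 < b := by linarith
  obtain ha | ha := le_total a 0
  · have hceil : ∀ n : ℕ, ⌈a * Real.log n⌉₊ = 0 := fun n =>
      Nat.ceil_eq_zero.2 (mul_nonpos_of_nonpos_of_nonneg ha (Real.log_natCast_nonneg n))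
    simpa only [hceil, pow_zero] using tendsto_one_div_atTop_nhds_zero_nat
  have hlim : Tendsto (fun n : ℕ => b * Real.exp ((a * Real.log b - 1) * Real.log n)) atTop
      (𝓝 (b * 0)) :=
    (Real.tendsto_exp_atBot.comp
      (tendsto_log_natCast.const_mul_atTop_of_neg (by linarith))).const_mul b
  rw [mul_zero] at hlim
  refine squeeze_zero' (Eventually.of_forall fun n => by positivity) ?_ hlim
  filter_upwards [eventually_gt_atTop 0] with n hn
  have hceil : (⌈a * Real.log n⌉₊ : ℝ) ≤ a * Real.log n + 1 :=
    (Nat.ceil_lt_add_one (mul_nonneg ha (Real.log_natCast_nonneg n))).le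
  have hpow : b ^ ⌈a * Real.log n⌉₊ ≤ b * Real.exp (a * Real.log b * Real.log n) :=
    calc b ^ ⌈a * Real.log n⌉₊ = Real.exp (⌈a * Real.log n⌉₊ * Real.log b) := by
          rw [Real.exp_nat_mul, Real.exp_log hb0]
      _ ≤ Real.exp (Real.log b + a * Real.log b * Real.log n) := by
          rw [Real.exp_le_exp]
          linarith [mul_le_mul_of_nonneg_right hceil (Real.log_nonneg hb)]
      _ = _ := by rw [Real.exp_add, Real.exp_log hb0]
  rw [sub_mul, one_mul, Real.exp_sub, Real.exp_log (Nat.cast_pos.2 hn), ← mul_div_assoc]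
  gcongr

theorem tendsto_pow_ceil_log_mul_atTop (hb : b ∈ Set.Ico 0 1) (ha : 0 < a) :
    Tendsto (fun n : ℕ => b ^ ⌈(-(1 / Real.log b) - a) * Real.log n⌉₊ * (n : ℝ)) atTop atTop := by
  obtain rfl | hb0 := hb.1.eq_or_lt
  · have hceil : ∀ n : ℕ, ⌈(-(1 / Real.log 0) - a) * Real.log n⌉₊ = 0 := fun n => by
      rw [Nat.ceil_eq_zero, Real.log_zero, div_zero, neg_zero, zero_sub]
      exact mul_nonpos_of_nonpos_of_nonneg (by linarith) (Real.log_natCast_nonneg n)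
    simpa only [hceil, pow_zero, one_mul] using tendsto_natCast_atTop_atTop
  have hlogb : Real.log b < 0 := Real.log_neg hb0 hb.2
  have hab : (-(1 / Real.log b) - a) * Real.log b⁻¹ < 1 := by
    rw [Real.log_inv, sub_mul, neg_mul_neg, one_div_mul_cancel hlogb.ne]
    linarith [mul_neg_of_pos_of_neg ha hlogb]
  have hinv : Tendsto (fun n : ℕ => b⁻¹ ^ ⌈(-(1 / Real.log b) - a) * Real.log n⌉₊ / (n : ℝ)) atTop
      (𝓝[>] 0) := by
    refine tendsto_nhdsWithin_iff.2
      ⟨tendsto_pow_ceil_log_div (one_le_inv₀ hb0 |>.2 hb.2.le) hab, ?_⟩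
    filter_upwards [eventually_gt_atTop 0] with n hn
    exact Set.mem_Ioi.2 (by positivity)
  refine (tendsto_inv_nhdsGT_zero.comp hinv).congr fun n => ?_
  simp [div_eq_mul_inv, mul_comm]

theorem eventually_mul_log_lt_neg_one {ι : Type*} {l : Filter ι} {f : ι → ℝ} (hb : b ∈ Set.Ioo 0 1)
    (hf : Tendsto f l (𝓝 b)) (ha : 0 < a) :
    ∀ᶠ i in l, (a - 1 / Real.log b) * Real.log (f i) < -1 := by
  have hlogb : Real.log b < 0 := Real.log_neg hb.1 hb.2
  refine ((hf.log hb.1.ne').const_mul (a - 1 / Real.log b)).eventually (gt_mem_nhds ?_)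
  rw [sub_mul, one_div_mul_cancel hlogb.ne]
  linarith [mul_neg_of_pos_of_neg ha hlogb]

theorem eventually_mul_log_lt_neg_one_of_nhdsGT {ι : Type*} {l : Filter ι} {f : ι → ℝ}
    (hb : b ∈ Set.Ico 0 1) (hf : Tendsto f l (𝓝[>] b)) (ha : 0 < a) :
    ∀ᶠ i in l, (a - 1 / Real.log b) * Real.log (f i) < -1 := by
  obtain rfl | hb0 := hb.1.eq_or_lt
  · filter_upwards [((Real.tendsto_log_nhdsGT_zero.comp hf).const_mul_atBot ha).eventually
      (eventually_lt_atBot (-1))] with i hi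
    simpa using hi
  · exact eventually_mul_log_lt_neg_one ⟨hb0, hb.2⟩ (hf.mono_right nhdsWithin_le_nhds) ha

theorem tendsto_phase_errors {β₀ β₁ β₂ β₃ r₁ r₃ d : ℝ} (hβ₀ : β₀ ∈ Set.Ico 0 1)
    (hβ₁ : β₁ ∈ Set.Ioc 0 1) (hβ₂ : β₂ ∈ Set.Ico 0 1) (hβ₃ : β₃ ∈ Set.Ioc 0 1) (hd : 0 < d)
    (hr₁ : r₁ * Real.log β₁ < -1) (hr₃ : r₃ * Real.log β₃ < -1) (K : ℝ) :
    Tendsto (fun n : ℕ => β₀ ^ ⌈d * Real.log n⌉₊ * K + (β₁ ^ ⌈r₁ * Real.log n⌉₊ * (2 * n) +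
      (β₂ ^ ⌈d * Real.log n⌉₊ * K + β₃ ^ ⌈r₃ * Real.log n⌉₊ * n))) atTop (𝓝 0) := by
  have hlim := ((tendsto_pow_ceil_log hβ₀ hd).mul_const K).add
    (((tendsto_pow_ceil_log_mul hβ₁ hr₁).const_mul 2).add
      (((tendsto_pow_ceil_log hβ₂ hd).mul_const K).add (tendsto_pow_ceil_log_mul hβ₃ hr₃)))
  simpa only [zero_mul, mul_zero, add_zero, mul_left_comm (2 : ℝ)] using hlim

theorem ceil_add_le_floor {a r₁ r₃ L : ℝ} (hr₁ : r₁ ≤ 0) (hr₃ : r₃ ≤ 0) (ha : 0 < a)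
    (hL : 20 / a ≤ L) :
    ⌈a / 5 * L⌉₊ + (⌈(a / 5 - r₁) * L⌉₊ + (⌈a / 5 * L⌉₊ + ⌈(a / 5 - r₃) * L⌉₊)) ≤
      ⌊(a - r₁ - r₃) * L⌋₊ := by
  have hL0 : 0 ≤ L := le_trans (by positivity) hL
  have haL : 20 ≤ L * a := (div_le_iff₀ ha).1 hL
  have h₀ := Nat.ceil_lt_add_one (show 0 ≤ a / 5 * L by positivity)
  have h₁ := Nat.ceil_lt_add_one (mul_nonneg (show 0 ≤ a / 5 - r₁ by linarith) hL0)
  have h₃ := Nat.ceil_lt_add_one (mul_nonneg (show 0 ≤ a / 5 - r₃ by linarith) hL0)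
  refine Nat.le_floor ?_
  push_cast
  linarith

theorem exists_tendsto_zero_of_eventually {Q : ℕ → ℝ → Prop}
    (hmono : ∀ n a b, a ≤ b → Q n a → Q n b) (h : ∀ a, 0 < a → ∀ᶠ n in atTop, Q n a) :
    ∃ δ : ℕ → ℝ, (∀ n, 0 ≤ δ n) ∧ Tendsto δ atTop (𝓝 0) ∧ ∀ᶠ n in atTop, Q n (δ n) := by
  set i : ℕ → ℝ := fun n => sInf {a | 0 < a ∧ Q n a}
  have hi0 : ∀ n, 0 ≤ i n := fun n => Real.sInf_nonneg fun a ha => ha.1.le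
  have hilim : Tendsto i atTop (𝓝 0) := by
    refine tendsto_order.2 ⟨fun a ha => Eventually.of_forall fun n => ha.trans_le (hi0 n),
      fun a ha => ?_⟩
    filter_upwards [h (a / 2) (half_pos ha)] with n hn
    have hbdd : BddBelow {a | 0 < a ∧ Q n a} := ⟨0, fun a ha => ha.1.le⟩
    exact (csInf_le hbdd ⟨half_pos ha, hn⟩).trans_lt (half_lt_self ha)
  refine ⟨fun n => i n + 1 / ((n : ℝ) + 1), fun n => add_nonneg (hi0 n) (by positivity), ?_, ?_⟩
  · simpa using hilim.add tendsto_one_div_add_atTop_nhds_zero_nat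
  · filter_upwards [h 1 one_pos] with n hn
    obtain ⟨a, ha, hlt⟩ := exists_lt_of_csInf_lt (s := {a | 0 < a ∧ Q n a}) ⟨1, one_pos, hn⟩
      (show i n < i n + 1 / ((n : ℝ) + 1) from lt_add_of_pos_right _ (by positivity))
    exact hmono n a _ hlt.le ha.2

theorem exists_isLittleO_log_of_eventually {Ω ι : ℕ → Type*} [∀ n, MeasurableSpace (Ω n)]
    {μ : ∀ n, Measure (Ω n)} [∀ n, IsFiniteMeasure (μ n)] {E : ∀ n, ι n → ℝ → Set (Ω n)}
    (hE : ∀ n v, Monotone (E n v))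
    (h : ∀ a, 0 < a → ∀ᶠ n : ℕ in atTop, ∀ v, 1 - 2 * a ≤ (μ n).real (E n v (a * Real.log n))) :
    ∃ g : ℕ → ℝ, (∀ n, 0 < g n) ∧ g =o[atTop] (fun n : ℕ => Real.log n) ∧
      ∀ η : ℝ, 0 < η → ∀ᶠ n : ℕ in atTop, ∀ v, 1 - η ≤ (μ n).real (E n v (g n)) := by
  have hE' : ∀ n v r r', r ≤ r' → (μ n).real (E n v r) ≤ (μ n).real (E n v r') :=
    fun n v _ _ hr => measureReal_mono (hE n v hr)
  have hlog : ∀ n : ℕ, 0 ≤ Real.log n := Real.log_natCast_nonneg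
  obtain ⟨δ, hδ0, hδ, hQ⟩ := exists_tendsto_zero_of_eventually
    (Q := fun n a => ∀ v, 1 - 2 * a ≤ (μ n).real (E n v (a * Real.log n)))
    (fun n a b hab ha v => by
      linarith [ha v, hE' n v _ _ (mul_le_mul_of_nonneg_right hab (hlog n))]) h
  refine ⟨fun n => δ n * Real.log n + 1,
    fun n => add_pos_of_nonneg_of_pos (mul_nonneg (hδ0 n) (hlog n)) one_pos,
    IsLittleO.add ?_ ?_, fun η hη => ?_⟩
  · simpa using ((isLittleO_one_iff ℝ).2 hδ).mul_isBigO (isBigO_refl (fun n : ℕ => Real.log n) _)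
  · exact isLittleO_const_left.2 (.inr (tendsto_norm_atTop_atTop.comp tendsto_log_natCast))
  · filter_upwards [hQ, hδ.eventually (gt_mem_nhds (half_pos hη))] with n hn hδn v
    linarith [hn v, hE' n v _ _ (le_add_of_nonneg_right (a := δ n * Real.log n) zero_le_one)]

end Asymptotics

/-! ### Runtimes on sequences of graphs -/

section Sequences

variable {H : ∀ n : ℕ, SimpleGraph (Fin n)} [∀ n, DecidableRel (H n).Adj] {q : unitInterval}
  {a c : ℝ}

/-- The graphs `H n` are eventually well spread with any small error `θ` and boundary expansion
`c`. This is all the runtime estimates need to know about the graphs with deleted edges. -/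
structure WellSpreadSequence (H : ∀ n : ℕ, SimpleGraph (Fin n)) [∀ n, DecidableRel (H n).Adj]
    (c : ℝ) : Prop where
  pos : 0 < c
  le_one : c ≤ 1
  eventually_wellSpread : ∀ᶠ θ in 𝓝[>] 0, ∀ᶠ n in atTop, ∃ D, WellSpread (H n) D θ c

theorem IsExpanderSequence.wellSpreadSequence {G : ∀ n : ℕ, SimpleGraph (Fin n)}
    [∀ n, DecidableRel (G n).Adj] (hG : IsExpanderSequence G) {ε : ℝ} (hε : 0 < ε)
    (hε' : ε < 1 / 2) (hH : ∀ n, IsEdgeDeletion (G n) (H n) (1 / 2 + ε)) :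
    WellSpreadSequence H (ε / 2) where
  pos := by positivity
  le_one := by linarith
  eventually_wellSpread := by
    filter_upwards [Ioc_mem_nhdsGT (show 0 < ε / 4 by positivity)] with θ hθ
    exact (hG.eventually_wellSpread hε hε' hH hθ.1 hθ.2).mono fun _ h => ⟨_, h⟩

theorem tendsto_finish_rate (hq : 0 < q) :
    Tendsto (fun x : ℝ => 1 - q * (1 - 4 * x)) (𝓝[>] 0) (𝓝[>] (1 - q)) := by
  have hcont : ContinuousAt (fun x : ℝ => 1 - q * (1 - 4 * x)) 0 := by fun_prop
  refine tendsto_nhdsWithin_iff.2 ⟨?_, ?_⟩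
  · simpa using hcont.tendsto.mono_left nhdsWithin_le_nhds
  · filter_upwards [self_mem_nhdsWithin] with x hx
    have : 0 < q * x := mul_pos hq hx
    exact Set.mem_Ioi.2 (by linarith)

theorem one_sub_mul_mem_Ico {q c : ℝ} (hq : 0 < q) (hq1 : q ≤ 1) (hc : 0 < c) (hc1 : c ≤ 1) :
    1 - q * c ∈ Set.Ico 0 1 :=
  ⟨sub_nonneg.2 (mul_le_one₀ hq1 hc.le hc1), sub_lt_self _ (mul_pos hq hc)⟩

theorem exists_phase_rates (hq : 0 < q) {β : ℝ → ℝ} {b d : ℝ} (hb : b ∈ Set.Ioo 0 1)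
    (hβ : Tendsto β (𝓝[>] 0) (𝓝 b)) (hd : 0 < d) {p : ℝ → Prop} (hp : ∀ᶠ x in 𝓝[>] 0, p x) :
    ∃ x ∈ Set.Ioc (0 : ℝ) 1, p x ∧ β x ∈ Set.Ioc 0 1 ∧ 1 - q * (1 - 4 * x) ∈ Set.Ioc (0 : ℝ) 1 ∧
      (d - 1 / Real.log b) * Real.log (β x) < -1 ∧
      (d - 1 / Real.log (1 - q)) * Real.log (1 - q * (1 - 4 * x)) < -1 := by
  have hq0 : (0 : ℝ) < q := hq
  have hfinish := tendsto_finish_rate hq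
  have hq1 : 1 - (q : ℝ) ∈ Set.Ico 0 1 := ⟨sub_nonneg.2 q.2.2, by linarith⟩
  have hx_mem : ∀ᶠ x : ℝ in 𝓝[>] 0, x ∈ Set.Ioc (0 : ℝ) 1 := Ioc_mem_nhdsGT one_pos
  have hfinish_mem : ∀ᶠ x : ℝ in 𝓝[>] 0, 1 - q * (1 - 4 * x) ∈ Set.Ioc (0 : ℝ) 1 :=
    hfinish.eventually (mem_of_superset (Ioo_mem_nhdsGT hq1.2) fun y hy =>
      ⟨hq1.1.trans_lt hy.1, hy.2.le⟩)
  have hβ_mem : ∀ᶠ x in 𝓝[>] 0, β x ∈ Set.Ioc 0 1 := hβ.eventually (Ioc_mem_nhds hb.1 hb.2)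
  exact (hx_mem.and (hp.and (hβ_mem.and (hfinish_mem.and
    ((eventually_mul_log_lt_neg_one hb hβ hd).and
      (eventually_mul_log_lt_neg_one_of_nhdsGT hq1 hfinish hd)))))).exists

theorem WellSpreadSequence.eventually_measureReal_ne_univ_le (hH : WellSpreadSequence H c)
    (hq : 0 < q) {P : ∀ n, Protocol (Fin n)} (hP : ∀ n ρ I, pull ρ I ⊆ P n ρ I) {β : ℝ → ℝ} {b : ℝ}
    (hb : b ∈ Set.Ioo 0 1) (hβ : Tendsto β (𝓝[>] 0) (𝓝 b))
    (hgr : ∀ᶠ x in 𝓝[>] 0, ∀ n D, WellSpread (H n) D x c → Grows (H n) q (P n) x (β x))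
    (ha : 0 < a) :
    ∀ᶠ n : ℕ in atTop, ∀ v : Fin n, (processMeasure (H n) q).real {ω | informed (P n) v ω
      ⌊(a - 1 / Real.log b - 1 / Real.log (1 - q)) * Real.log n⌋₊ ≠ Set.univ} ≤ a := by
  have hc := hH.pos
  obtain ⟨x, ⟨hx, hx1⟩, ⟨hwell, hgrows⟩, hβx, hfinish, hβlog, hfinishlog⟩ :=
    exists_phase_rates hq hb hβ (show 0 < a / 5 by positivity) (hH.eventually_wellSpread.and hgr)
  have hstart := one_sub_mul_mem_Ico hq q.2.2 (c := c / 16) (by positivity)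
    (by linarith [hH.le_one])
  have hmiddle := one_sub_mul_mem_Ico hq q.2.2 (mul_pos hc hx) (mul_le_one₀ hH.le_one hx.le hx1)
  rw [← mul_div_assoc] at hstart
  rw [← mul_assoc] at hmiddle
  filter_upwards [(tendsto_phase_errors hstart hβx hmiddle hfinish (show 0 < a / 5 by positivity)
      hβlog hfinishlog (2 / x)).eventually (gt_mem_nhds ha), hwell,
    tendsto_natCast_atTop_atTop.eventually (eventually_ge_atTop (2 / x)),
    tendsto_log_natCast.eventually (eventually_ge_atTop (20 / a))] with n herr ⟨D, hD⟩ hn hlog v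
  have hlogb : 1 / Real.log b ≤ 0 := one_div_nonpos.2 (Real.log_nonpos hb.1.le hb.2.le)
  have hlogq : 1 / Real.log (1 - q) ≤ 0 :=
    one_div_nonpos.2 (Real.log_nonpos (sub_nonneg.2 q.2.2) (sub_le_self _ q.2.1))
  refine (measureReal_informed_ne_univ_le (H n) q (fun ρ I => (subset_pull ρ I).trans (hP n ρ I))
    (ceil_add_le_floor hlogb hlogq ha hlog) v).trans (le_trans ?_ herr.le)
  have := hD.transition_iterate_ne_univ_le q (hP n) hc.le hH.le_one (hgrows n D hD) hβx.1.le hx hx1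
    (by simpa using hn) ⌈a / 5 * Real.log n⌉₊ ⌈(a / 5 - 1 / Real.log b) * Real.log n⌉₊
    ⌈a / 5 * Real.log n⌉₊ ⌈(a / 5 - 1 / Real.log (1 - q)) * Real.log n⌉₊ v
  simpa only [Fintype.card_fin] using this

theorem WellSpreadSequence.eventually_measureReal_pull_eq_univ_le (hH : WellSpreadSequence H c)
    (hq : 0 < q) (ha : 0 < a) :
    ∀ᶠ n : ℕ in atTop, ∀ v : Fin n, (processMeasure (H n) q).real {ω | informed pull v ω
      ⌊(1 / Real.log (1 + q) - 1 / Real.log (1 - q) - a) * Real.log n⌋₊ = Set.univ} ≤ a := by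
  have hq0 : (0 : ℝ) < q := hq
  have hlogq : 0 < Real.log (1 + q) := Real.log_pos (by linarith)
  set s : ℕ → ℕ := fun n => ⌈(1 / Real.log (1 + q) - a / 2) * Real.log n⌉₊
  set t : ℕ → ℕ := fun n => ⌈(-(1 / Real.log (1 - q)) - a / 2) * Real.log n⌉₊
  have hgrowth : Tendsto (fun n : ℕ => (1 + q : ℝ) ^ s n / (n : ℝ)) atTop (𝓝 0) := by
    refine tendsto_pow_ceil_log_div (by linarith) ?_
    rw [sub_mul, one_div_mul_cancel hlogq.ne']
    linarith [mul_pos ha hlogq]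
  have hsurvive : Tendsto (fun n : ℕ => (1 - q : ℝ) ^ t n * (n : ℝ)) atTop atTop :=
    tendsto_pow_ceil_log_mul_atTop ⟨sub_nonneg.2 q.2.2, by linarith⟩ (half_pos ha)
  have herr : Tendsto (fun n : ℕ => 4 * ((1 + q : ℝ) ^ s n / (n : ℝ)) +
      Real.exp (-((1 - q : ℝ) ^ t n * (n : ℝ) / 2))) atTop (𝓝 (4 * 0 + 0)) :=
    (hgrowth.const_mul 4).add
      (Real.tendsto_exp_neg_atTop_nhds_zero.comp (hsurvive.atTop_div_const two_pos))
  rw [mul_zero, add_zero] at herr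
  obtain ⟨θ, hwell⟩ := hH.eventually_wellSpread.exists
  filter_upwards [herr.eventually (gt_mem_nhds ha), hwell] with n hn ⟨D, hD⟩ v
  have hst : ⌊(1 / Real.log (1 + q) - 1 / Real.log (1 - q) - a) * Real.log n⌋₊ ≤ s n + t n := by
    refine Nat.floor_le_of_le ?_
    push_cast
    linarith [Nat.le_ceil ((1 / Real.log (1 + q) - a / 2) * Real.log n),
      Nat.le_ceil ((-(1 / Real.log (1 - q)) - a / 2) * Real.log n)]
  refine (measureReal_informed_eq_univ_le (H n) q subset_pull hst v).trans ?_
  refine (hD.transition_iterate_pull_univ_le q (s n) (t n) v).trans ?_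
  simpa only [Fintype.card_fin] using hn.le

theorem one_sub_measureReal_le_of_compl_subset {Ω : Type*} [MeasurableSpace Ω] {μ : Measure Ω}
    [IsProbabilityMeasure μ] {A E : Set Ω} (h : Aᶜ ⊆ E) : 1 - μ.real A ≤ μ.real E := by
  have hunion : μ.real Set.univ ≤ μ.real (A ∪ E) := measureReal_mono fun ω _ =>
    (em (ω ∈ A)).imp_right fun hω => h hω
  rw [probReal_univ] at hunion
  linarith [measureReal_union_le (μ := μ) A E]

theorem tendsto_pull_growth_rate (hq : 0 < q) :
    Tendsto (fun x : ℝ => 1 / (1 + q * (1 - 4 * x)) + 2 * x) (𝓝[>] 0) (𝓝 (1 + q)⁻¹) := by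
  have hq0 : (0 : ℝ) < q := hq
  have hcont : ContinuousAt (fun x : ℝ => 1 / (1 + q * (1 - 4 * x)) + 2 * x) 0 :=
    (continuousAt_const.div (by fun_prop) (by norm_num; positivity)).add (by fun_prop)
  simpa using hcont.tendsto.mono_left nhdsWithin_le_nhds

theorem tendsto_pushPull_growth_rate (hq : 0 < q) :
    Tendsto (fun x : ℝ => 1 / (1 + 2 * q * (1 - 8 * x)) + 144 * x) (𝓝[>] 0)
      (𝓝 (1 + 2 * q)⁻¹) := by
  have hq0 : (0 : ℝ) < q := hq
  have hcont : ContinuousAt (fun x : ℝ => 1 / (1 + 2 * q * (1 - 8 * x)) + 144 * x) 0 :=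
    (continuousAt_const.div (by fun_prop) (by norm_num; positivity)).add (by fun_prop)
  simpa using hcont.tendsto.mono_left nhdsWithin_le_nhds

theorem inv_mem_Ioo_of_one_lt {b : ℝ} (hb : 1 < b) : b⁻¹ ∈ Set.Ioo 0 1 :=
  ⟨by positivity, inv_lt_one_of_one_lt₀ hb⟩

theorem sub_one_div_log_inv_sub (a b d : ℝ) :
    a - 1 / Real.log b⁻¹ - d = 1 / Real.log b - d + a := by
  rw [Real.log_inv, one_div_neg_eq_neg_one_div]
  ring

theorem eventually_mul_le_one (k : ℝ) : ∀ᶠ x in 𝓝[>] (0 : ℝ), 0 < x ∧ k * x ≤ 1 := by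
  have hk : Tendsto (fun x : ℝ => k * x) (𝓝[>] 0) (𝓝 (k * 0)) :=
    ((continuous_const_mul k).tendsto 0).mono_left nhdsWithin_le_nhds
  rw [mul_zero] at hk
  filter_upwards [self_mem_nhdsWithin, hk.eventually (Iic_mem_nhds one_pos)] with x hx hkx
    using ⟨hx, hkx⟩

theorem WellSpreadSequence.eventually_measureReal_pull_ne_univ_le (hH : WellSpreadSequence H c)
    (hq : 0 < q) (ha : 0 < a) :
    ∀ᶠ n : ℕ in atTop, ∀ v : Fin n, (processMeasure (H n) q).real {ω | informed pull v ω
      ⌊(1 / Real.log (1 + q) - 1 / Real.log (1 - q) + a) * Real.log n⌋₊ ≠ Set.univ} ≤ a := by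
  have hq0 : (0 : ℝ) < q := hq
  have h := hH.eventually_measureReal_ne_univ_le hq (P := fun _ => pull)
    (fun _ _ _ => Set.Subset.rfl) (inv_mem_Ioo_of_one_lt (by linarith))
    (tendsto_pull_growth_rate hq) ((eventually_mul_le_one 4).mono fun x hx n D hD =>
      hD.grows_pull q hx.1 hx.2) ha
  simpa only [sub_one_div_log_inv_sub] using h

theorem WellSpreadSequence.eventually_measureReal_pushPull_ne_univ_le
    (hH : WellSpreadSequence H c) (hq : 0 < q) (ha : 0 < a) :
    ∀ᶠ n : ℕ in atTop, ∀ v : Fin n, (processMeasure (H n) q).real {ω | informed pushPull v ω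
      ⌊(1 / Real.log (1 + 2 * q) - 1 / Real.log (1 - q) + a) * Real.log n⌋₊ ≠ Set.univ} ≤ a := by
  have hq0 : (0 : ℝ) < q := hq
  have h := hH.eventually_measureReal_ne_univ_le hq (P := fun _ => pushPull)
    (fun _ => pull_subset_pushPull) (inv_mem_Ioo_of_one_lt (by linarith))
    (tendsto_pushPull_growth_rate hq) ((eventually_mul_le_one 8).mono fun x hx n D hD =>
      hD.grows_pushPull q hx.1 hx.2) ha
  simpa only [sub_one_div_log_inv_sub] using h

theorem one_div_log_sub_one_div_log_nonneg {b : ℝ} (hb : 1 ≤ b) (q : unitInterval) :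
    0 ≤ 1 / Real.log b - 1 / Real.log (1 - q) :=
  sub_nonneg.2 ((one_div_nonpos.2 (Real.log_nonpos (sub_nonneg.2 q.2.2)
    (sub_le_self _ q.2.1))).trans (one_div_nonneg.2 (Real.log_nonneg hb)))

theorem exists_runtime_eq_of_informed_floor {V : Type*} {P : Protocol V} {v : V}
    {ω : ℕ → Round V} {r : ℝ} (hr : 0 ≤ r) (h : informed P v ω ⌊r⌋₊ = Set.univ) :
    ∃ t : ℕ, runtime P v ω = t ∧ informed P v ω t = Set.univ ∧ (t : ℝ) ≤ r := by
  obtain ⟨t, ht, htuniv, hle⟩ := exists_runtime_eq h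
  exact ⟨t, ht, htuniv, (Nat.le_floor_iff hr).1 hle⟩

theorem WellSpreadSequence.exists_isLittleO_runtime_pull (hH : WellSpreadSequence H c)
    (hq : 0 < q) :
    ∃ g : ℕ → ℝ, (∀ n, 0 < g n) ∧ g =o[atTop] (fun n : ℕ => Real.log n) ∧
      ∀ η : ℝ, 0 < η → ∀ᶠ n : ℕ in atTop, ∀ v : Fin n,
        1 - η ≤ (processMeasure (H n) q).real {ω | ∃ t : ℕ, runtime pull v ω = t ∧
          |(t : ℝ) - (1 / Real.log (1 + q) - 1 / Real.log (1 - q)) * Real.log n| ≤ g n} := by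
  have hC := one_div_log_sub_one_div_log_nonneg (le_add_of_nonneg_right q.2.1) q
  set C := 1 / Real.log (1 + q) - 1 / Real.log (1 - q)
  refine exists_isLittleO_log_of_eventually
    (E := fun n v r => {ω | ∃ t : ℕ, runtime pull v ω = t ∧ |(t : ℝ) - C * Real.log n| ≤ r})
    (fun n v r r' hr ω ⟨t, ht, hle⟩ => ⟨t, ht, hle.trans hr⟩) fun a ha => ?_
  filter_upwards [hH.eventually_measureReal_pull_ne_univ_le hq ha,
    hH.eventually_measureReal_pull_eq_univ_le hq ha] with n hlate hearly v
  refine le_trans ?_ (one_sub_measureReal_le_of_compl_subset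
    (A := {ω | informed pull v ω ⌊(C + a) * Real.log n⌋₊ ≠ Set.univ} ∪
      {ω | informed pull v ω ⌊(C - a) * Real.log n⌋₊ = Set.univ}) fun ω hω => ?_)
  · linarith [hlate v, hearly v, measureReal_union_le (μ := processMeasure (H n) q)
      {ω | informed pull v ω ⌊(C + a) * Real.log n⌋₊ ≠ Set.univ}
      {ω | informed pull v ω ⌊(C - a) * Real.log n⌋₊ = Set.univ}]
  · obtain ⟨hfinished, hunfinished⟩ := not_or.1 hω
    have : 0 ≤ Real.log n := Real.log_natCast_nonneg n
    obtain ⟨t, ht, htuniv, hle⟩ :=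
      exists_runtime_eq_of_informed_floor (by positivity) (not_not.1 hfinished)
    have hlt : (C - a) * Real.log n < t := Nat.lt_of_floor_lt (lt_of_not_ge fun htle =>
      hunfinished (informed_eq_univ_of_le subset_pull htle htuniv))
    exact ⟨t, ht, abs_le.2 ⟨by linarith, by linarith⟩⟩

theorem WellSpreadSequence.exists_isLittleO_runtime_pushPull_le (hH : WellSpreadSequence H c)
    (hq : 0 < q) :
    ∃ g : ℕ → ℝ, (∀ n, 0 < g n) ∧ g =o[atTop] (fun n : ℕ => Real.log n) ∧
      ∀ η : ℝ, 0 < η → ∀ᶠ n : ℕ in atTop, ∀ v : Fin n,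
        1 - η ≤ (processMeasure (H n) q).real {ω | ∃ t : ℕ, runtime pushPull v ω = t ∧
          (t : ℝ) ≤ (1 / Real.log (1 + 2 * q) - 1 / Real.log (1 - q)) * Real.log n + g n} := by
  have hC := one_div_log_sub_one_div_log_nonneg
    (le_add_of_nonneg_right (mul_nonneg zero_le_two q.2.1)) q
  set C := 1 / Real.log (1 + 2 * q) - 1 / Real.log (1 - q)
  refine exists_isLittleO_log_of_eventually
    (E := fun n v r => {ω | ∃ t : ℕ, runtime pushPull v ω = t ∧ (t : ℝ) ≤ C * Real.log n + r})
    (fun n v r r' hr ω ⟨t, ht, hle⟩ => ⟨t, ht, hle.trans (by gcongr)⟩) fun a ha => ?_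
  filter_upwards [hH.eventually_measureReal_pushPull_ne_univ_le hq ha] with n hlate v
  refine le_trans ?_ (one_sub_measureReal_le_of_compl_subset
    (A := {ω | informed pushPull v ω ⌊(C + a) * Real.log n⌋₊ ≠ Set.univ}) fun ω hω => ?_)
  · linarith [hlate v]
  · have : 0 ≤ Real.log n := Real.log_natCast_nonneg n
    obtain ⟨t, ht, -, hle⟩ :=
      exists_runtime_eq_of_informed_floor (by positivity) (not_not.1 hω)
    exact ⟨t, ht, by rwa [← add_mul]⟩

theorem cPull_eq (q : ℝ) : cPull q = 1 / Real.log (1 + q) - 1 / Real.log (1 - q) := by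
  unfold cPull
  split_ifs with h
  · norm_num [h]
  · rfl

theorem cPushPull_one : cPushPull 1 = 1 / Real.log (1 + 2 * 1) - 1 / Real.log (1 - 1) := by
  norm_num [cPushPull]

end Sequences

end

end RumorSpreading

open RumorSpreading

theorem mainTheorem1_general {ε : ℝ} (hε : 0 < ε) (hε' : ε < 1 / 2) {q : unitInterval} (hq : 0 < q)
    {G G' : ∀ n : ℕ, SimpleGraph (Fin n)}
    [∀ n, DecidableRel (G n).Adj] [∀ n, DecidableRel (G' n).Adj]
    (hG : IsExpanderSequence G) (hG' : ∀ n, IsEdgeDeletion (G n) (G' n) (1 / 2 + ε)) :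
    (∃ g : ℕ → ℝ, (∀ n, 0 < g n) ∧ g =o[atTop] (fun n : ℕ => Real.log n) ∧
      ∀ η : ℝ, 0 < η → ∀ᶠ n : ℕ in atTop, ∀ v : Fin n,
        1 - η ≤ (processMeasure (G' n) q).real {ω | ∃ t : ℕ, runtime pull v ω = (t : ℕ∞) ∧
          |(t : ℝ) - cPull q * Real.log n| ≤ g n}) ∧
    -- For `q = 1` the second fraction is `1 / log 0 = 0`, which is also its limit as `q → 1`.
    ∃ g : ℕ → ℝ, (∀ n, 0 < g n) ∧ g =o[atTop] (fun n : ℕ => Real.log n) ∧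
      ∀ η : ℝ, 0 < η → ∀ᶠ n : ℕ in atTop, ∀ v : Fin n,
        1 - η ≤ (processMeasure (G' n) q).real {ω | ∃ t : ℕ, runtime pushPull v ω = (t : ℕ∞) ∧
          (t : ℝ) ≤ (1 / Real.log (1 + 2 * q) - 1 / Real.log (1 - q)) * Real.log n + g n} := by
  have hwell := hG.wellSpreadSequence hε hε' hG'
  rw [cPull_eq]
  exact ⟨hwell.exists_isLittleO_runtime_pull hq, hwell.exists_isLittleO_runtime_pushPull_le hq⟩

theorem mainTheorem1 (ε : ℝ) (hε : 0 < ε) (hε' : ε < 1 / 2) (q : unitInterval) (hq : 0 < q)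
    (G G' : ∀ n : ℕ, SimpleGraph (Fin n))
    [∀ n, DecidableRel (G n).Adj] [∀ n, DecidableRel (G' n).Adj]
    (hG : RumorSpreading.IsExpanderSequence G)
    (hG' : ∀ n, RumorSpreading.IsEdgeDeletion (G n) (G' n) (1 / 2 + ε)) :
    -- (a): `T_pull(G'_n, q) = c_pull(q) log n + o(log n)` whp, uniformly in the initial vertex
    (∃ g : ℕ → ℝ, (∀ n, 0 < g n) ∧ g =o[atTop] (fun n : ℕ => Real.log n) ∧
      ∀ η : ℝ, 0 < η → ∀ᶠ n : ℕ in atTop, ∀ v : Fin n,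
        1 - η ≤ (RumorSpreading.processMeasure (G' n) q).real
          {ω | ∃ t : ℕ, RumorSpreading.runtime RumorSpreading.pull v ω = (t : ℕ∞) ∧
            |(t : ℝ) - RumorSpreading.cPull q * Real.log n| ≤ g n}) ∧
    -- (b): `T_pp(G'_n, 1) ≤ c_pp(1) log n + o(log n)` whp, if `δ(G_n) ≥ α n`
    (∀ α : ℝ, 0 < α → α ≤ 1 → (∀ᶠ n : ℕ in atTop, α * (n : ℝ) ≤ ((G n).minDegree : ℝ)) →
      ∃ g : ℕ → ℝ, (∀ n, 0 < g n) ∧ g =o[atTop] (fun n : ℕ => Real.log n) ∧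
        ∀ η : ℝ, 0 < η → ∀ᶠ n : ℕ in atTop, ∀ v : Fin n,
          1 - η ≤ (RumorSpreading.processMeasure (G' n) 1).real
            {ω | ∃ t : ℕ, RumorSpreading.runtime RumorSpreading.pushPull v ω = (t : ℕ∞) ∧
              (t : ℝ) ≤ RumorSpreading.cPushPull 1 * Real.log n + g n}) := by
  refine ⟨(mainTheorem1_general hε hε' hq hG hG').1, fun _ _ _ _ => ?_⟩
  exact cPushPull_one ▸ (mainTheorem1_general hε hε' (q := 1) one_pos hG hG').2
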